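/- Let $K$ be a field with $\operatorname{char} K\neq 3$, let $n\ge 2$, and let $F\in K[x_0,\dots,x_n]$ be homogeneous of degree $3$. Let $X_F=\operatorname{Proj}\bigl(K[x_0,\dots,x_n]/(F)\bigr)\subset\mathbf P^n_K$. Let $\Gamma$ be the flag variety of pairs $(p,L)$ of a point $p$ and a line $L$ in $\mathbf P^n_K$ with $p\in L$, and let $Y_{F,3}\subset\Gamma$ be the closed subscheme of the pairs $(p,L)$ such that $L$ intersects $X_F$ at $p$ with multiplicity at least $3$; that is, if $p$ is represented by a vector $u$, $L$ is spanned by $u$ and $v$, and $F(u+tv)=\sum_k f_k(u,v)\,t^k$, then $Y_{F,3}$ is defined locally on $\Gamma$ by the equations $f_0=f_1=f_2=0$. Then $Y_{F,3}$ is smooth over $K$ of dimension $2n-4$ if and only if $X_F$ is a smooth hypersurface, i.e. smooth over $K$ of dimension $n-1$. -/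

import Mathlib

open AlgebraicGeometry CategoryTheory

noncomputable section

namespace PointLine

universe u

attribute [local instance] MvPolynomial.gradedAlgebra

/-! ### Closed subschemes of projective space given by homogeneous ideals -/

section ProjQuotient

variable {K : Type u} [Field K] {σ : Type} (I : Ideal (MvPolynomial σ K))

/-- The grading of `K[σ] / I`: the degree `k` part consists of the classes of the homogeneous
polynomials of degree `k`. -/
def quotGrading (k : ℕ) : Submodule K (MvPolynomial σ K ⧸ I) :=
  (MvPolynomial.homogeneousSubmodule σ K k).map (Ideal.Quotient.mkₐ K I).toLinearMap

instance quotGrading_gradedMonoid : SetLike.GradedMonoid (quotGrading I) where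
  one_mem := ⟨1, MvPolynomial.isHomogeneous_one σ K, map_one (Ideal.Quotient.mkₐ K I)⟩
  mul_mem := by
    rintro i j _ _ ⟨a, ha, rfl⟩ ⟨b, hb, rfl⟩
    exact ⟨a * b, MvPolynomial.IsHomogeneous.mul ha hb, map_mul (Ideal.Quotient.mkₐ K I) a b⟩

/-- Sends a polynomial to the family of the classes of its homogeneous components. -/
def quotDecomposeAux : MvPolynomial σ K →ₗ[K] DirectSum ℕ fun k => quotGrading I k :=
  (DirectSum.lmap fun k => (Ideal.Quotient.mkₐ K I).toLinearMap.restrict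
      (p := MvPolynomial.homogeneousSubmodule σ K k) (q := quotGrading I k)
      fun x hx => ⟨x, hx, rfl⟩) ∘ₗ
    (DirectSum.decomposeLinearEquiv (MvPolynomial.homogeneousSubmodule σ K)).toLinearMap

theorem quotDecomposeAux_of_mem {k : ℕ} {p : MvPolynomial σ K}
    (hp : p ∈ MvPolynomial.homogeneousSubmodule σ K k) :
    quotDecomposeAux I p = DirectSum.of (fun k => quotGrading I k) k
      ⟨Ideal.Quotient.mkₐ K I p, ⟨p, hp, rfl⟩⟩ := by
  rw [quotDecomposeAux, LinearMap.comp_apply, LinearEquiv.coe_coe,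
    DirectSum.decomposeLinearEquiv_apply, DirectSum.decompose_of_mem _ hp, DirectSum.lmap_of]
  rfl

theorem quotDecomposeAux_congr
    (hI : I.IsHomogeneous (MvPolynomial.homogeneousSubmodule σ K)) {p q : MvPolynomial σ K}
    (h : Ideal.Quotient.mk I p = Ideal.Quotient.mk I q) :
    quotDecomposeAux I p = quotDecomposeAux I q := by
  have h0 : quotDecomposeAux I (p - q) = 0 := by
    refine DFinsupp.ext fun k => Subtype.ext ?_
    exact Ideal.Quotient.eq_zero_iff_mem.mpr (hI k (Ideal.Quotient.eq.mp h))
  rw [← sub_add_cancel p q, map_add, h0, zero_add]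

theorem coe_quotDecomposeAux (p : MvPolynomial σ K) :
    DirectSum.coeAddMonoidHom (quotGrading I) (quotDecomposeAux I p) =
      Ideal.Quotient.mk I p := by
  induction p using DirectSum.Decomposition.inductionOn
    (MvPolynomial.homogeneousSubmodule σ K) with
  | zero => rw [map_zero, map_zero, map_zero]
  | homogeneous m =>
    rw [quotDecomposeAux_of_mem I m.2, DirectSum.coeAddMonoidHom_of]
    rfl
  | add m m' h h' => rw [map_add, map_add, h, h', map_add]

/-- A polynomial representing a given class in `K[σ] / I`. -/
def quotSec (x : MvPolynomial σ K ⧸ I) : MvPolynomial σ K :=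
  Function.surjInv Ideal.Quotient.mk_surjective x

theorem mk_quotSec (x : MvPolynomial σ K ⧸ I) : Ideal.Quotient.mk I (quotSec I x) = x :=
  Function.surjInv_eq Ideal.Quotient.mk_surjective x

/-- For a homogeneous ideal `I`, the ring `K[σ] / I` is graded by `quotGrading I`. -/
@[reducible]
def quotGradedAlgebra (hI : I.IsHomogeneous (MvPolynomial.homogeneousSubmodule σ K)) :
    GradedAlgebra (quotGrading I) where
  decompose' x := quotDecomposeAux I (quotSec I x)
  left_inv x := by
    change DirectSum.coeAddMonoidHom (quotGrading I) (quotDecomposeAux I _) = x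
    rw [coe_quotDecomposeAux, mk_quotSec]
  right_inv x := by
    change quotDecomposeAux I (quotSec I
      (DirectSum.coeAddMonoidHom (quotGrading I) x)) = x
    induction x using DirectSum.induction_on with
    | zero =>
      rw [← map_zero (quotDecomposeAux I)]
      refine quotDecomposeAux_congr I hI ?_
      rw [mk_quotSec, map_zero, map_zero, map_zero]
    | of k x =>
      obtain ⟨_, p, hp, rfl⟩ := x
      refine Eq.trans (quotDecomposeAux_congr I hI ?_) (quotDecomposeAux_of_mem I hp)
      rw [mk_quotSec]
      exact DirectSum.coeAddMonoidHom_of (quotGrading I) k _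
    | add x y hx hy =>
      refine Eq.trans ?_ ((map_add (quotDecomposeAux I) _ _).trans (congrArg₂ (· + ·) hx hy))
      refine quotDecomposeAux_congr I hI ?_
      rw [mk_quotSec, map_add (Ideal.Quotient.mk I), mk_quotSec, mk_quotSec]
      exact map_add (DirectSum.coeAddMonoidHom (quotGrading I)) x y

/-- The closed subscheme `Proj (K[σ] / I)` of the projective space with coordinates indexed by `σ`
that is defined by a homogeneous ideal `I`. -/
def projQuot (hI : I.IsHomogeneous (MvPolynomial.homogeneousSubmodule σ K)) : Scheme.{u} :=
  letI := quotGradedAlgebra I hI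
  Proj (quotGrading I)

/-- The structure morphism `Proj (K[σ] / I) ⟶ Spec K`. -/
def projQuotToSpec (hI : I.IsHomogeneous (MvPolynomial.homogeneousSubmodule σ K)) :
    projQuot I hI ⟶ Spec (CommRingCat.of K) :=
  letI := quotGradedAlgebra I hI
  Proj.toSpecZero (quotGrading I) ≫
    Spec.map (CommRingCat.ofHom (algebraMap K (quotGrading I 0)))

end ProjQuotient

/-! ### The hypersurface `X_F` -/

section Hypersurface

variable {K : Type u} [Field K] {n d : ℕ} (F : MvPolynomial (Fin (n + 1)) K)

theorem hypersurfaceIdeal_isHomogeneous (hF : F.IsHomogeneous d) :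
    (Ideal.span {F}).IsHomogeneous (MvPolynomial.homogeneousSubmodule (Fin (n + 1)) K) := by
  refine Ideal.homogeneous_span _ _ ?_
  rintro _ rfl
  exact ⟨d, hF⟩

/-- The hypersurface `X_F = Proj (K[x₀, …, xₙ] / (F))` in `ℙⁿ`. -/
def hypersurface (hF : F.IsHomogeneous d) : Scheme.{u} :=
  projQuot (Ideal.span {F}) (hypersurfaceIdeal_isHomogeneous F hF)

/-- The structure morphism `X_F ⟶ Spec K`. -/
def hypersurfaceToSpec (hF : F.IsHomogeneous d) :
    hypersurface F hF ⟶ Spec (CommRingCat.of K) :=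
  projQuotToSpec (Ideal.span {F}) (hypersurfaceIdeal_isHomogeneous F hF)

end Hypersurface

/-! ### The scheme `Y_{F,m}` of pairs (point, line) with contact of order at least `m`

A pair `(p, L)` with `p ∈ L` is given by two linearly independent vectors `u, v`: the point `p` is
`[u]`, and the line `L` is spanned by `u` and `v`. The flag variety `Γ ⊆ ℙⁿ × 𝔾` of all such pairs
is embedded in a projective space by the Plücker embedding of the Grassmannian `𝔾` of lines
followed by the Segre embedding, which sends `(p, L)` to the point with the homogeneous coordinates
`z_{ijk} = u_i (u_j v_k - u_k v_j)`. -/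

section Contact

variable {K : Type u} [Field K] {n d : ℕ} (F : MvPolynomial (Fin (n + 1)) K)

/-- The ring `K[u₀, …, uₙ, v₀, …, vₙ]`. -/
abbrev PairRing (K : Type u) [Field K] (n : ℕ) : Type u :=
  MvPolynomial (Fin (n + 1) ⊕ Fin (n + 1)) K

/-- The coordinate `uᵢ`. -/
def uVar (K : Type u) [Field K] (n : ℕ) (i : Fin (n + 1)) : PairRing K n :=
  MvPolynomial.X (Sum.inl i)

/-- The coordinate `vᵢ`. -/
def vVar (K : Type u) [Field K] (n : ℕ) (i : Fin (n + 1)) : PairRing K n :=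
  MvPolynomial.X (Sum.inr i)

/-- The restriction `F(u + t v)` of `F` to the line through `u` and `v`, as a polynomial in the
local parameter `t` at the point `u` (where `t = 0`). -/
def restrictToLine : Polynomial (PairRing K n) :=
  MvPolynomial.aeval
    (fun i => Polynomial.C (uVar K n i) + Polynomial.X * Polynomial.C (vVar K n i)) F

/-- The ideal `(f₀, …, f_{m-1})` where `F(u + t v) = ∑ₖ fₖ(u, v) tᵏ`. It expresses that the line
through `u` and `v` intersects `X_F` at the point `u` with multiplicity at least `m`. -/
def contactIdeal (m : ℕ) : Ideal (PairRing K n) :=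
  Ideal.span {g | ∃ k < m, g = (restrictToLine F).coeff k}

/-- The Segre-Plücker map `z_{ijk} ↦ u_i (u_j v_k - u_k v_j)` on coordinate rings. -/
def segrePlucker (K : Type u) [Field K] (n : ℕ) :
    MvPolynomial (Fin (n + 1) × Fin (n + 1) × Fin (n + 1)) K →ₐ[K] PairRing K n :=
  MvPolynomial.aeval fun a =>
    uVar K n a.1 * (uVar K n a.2.1 * vVar K n a.2.2 - uVar K n a.2.2 * vVar K n a.2.1)

/-- The homogeneous ideal of `Y_{F,m}` in the Segre-Plücker embedding: it consists of the
polynomials in the `z_{ijk}` which lie in `(f₀, …, f_{m-1})` after the substitution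
`z_{ijk} = u_i (u_j v_k - u_k v_j)`. For `m = 0` this is the homogeneous ideal of the flag variety
`Γ`. On the chart of `Γ` with `u_i = 1`, `v_i = 0`, `v_j = 1`, where the `n` remaining `u`'s and the
`n - 1` remaining `v`'s are affine coordinates, the closed subscheme that it defines is the zero
scheme of `f₀, …, f_{m-1}`. -/
def contactSchemeIdeal (m : ℕ) :
    Ideal (MvPolynomial (Fin (n + 1) × Fin (n + 1) × Fin (n + 1)) K) :=
  (contactIdeal F m).comap (segrePlucker K n)

theorem restrictToLine_coeff_isHomogeneous (hF : F.IsHomogeneous d) (k : ℕ) :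
    ((restrictToLine F).coeff k).IsHomogeneous d := by
  have key : ∀ s : Fin (n + 1) →₀ ℕ, ∀ k : ℕ,
      ((s.prod fun i e => (Polynomial.C (uVar K n i) +
        Polynomial.X * Polynomial.C (vVar K n i)) ^ e).coeff k).IsHomogeneous s.degree := by
    have hmul : ∀ (P Q : Polynomial (PairRing K n)) (a b : ℕ),
        (∀ k, (P.coeff k).IsHomogeneous a) → (∀ k, (Q.coeff k).IsHomogeneous b) →
        ∀ k, ((P * Q).coeff k).IsHomogeneous (a + b) := by
      intro P Q a b hP hQ k
      rw [Polynomial.coeff_mul]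
      exact MvPolynomial.IsHomogeneous.sum _ _ _ fun x _ => (hP x.1).mul (hQ x.2)
    have hone : ∀ k, ((1 : Polynomial (PairRing K n)).coeff k).IsHomogeneous 0 := by
      intro k
      rw [Polynomial.coeff_one]
      split_ifs
      · exact MvPolynomial.isHomogeneous_one _ _
      · exact MvPolynomial.isHomogeneous_zero _ _ _
    have hlin : ∀ (i : Fin (n + 1)) (k : ℕ), ((Polynomial.C (uVar K n i) +
        Polynomial.X * Polynomial.C (vVar K n i)).coeff k).IsHomogeneous 1 := by
      intro i k
      rw [Polynomial.coeff_add, Polynomial.coeff_C, Polynomial.coeff_mul_C, Polynomial.coeff_X]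
      refine MvPolynomial.IsHomogeneous.add ?_ ?_
      · split_ifs
        · exact MvPolynomial.isHomogeneous_X _ _
        · exact MvPolynomial.isHomogeneous_zero _ _ _
      · split_ifs
        · rw [one_mul]; exact MvPolynomial.isHomogeneous_X _ _
        · rw [zero_mul]; exact MvPolynomial.isHomogeneous_zero _ _ _
    have hpow : ∀ (i : Fin (n + 1)) (e k : ℕ), (((Polynomial.C (uVar K n i) +
        Polynomial.X * Polynomial.C (vVar K n i)) ^ e).coeff k).IsHomogeneous e := by
      intro i e
      induction e with
      | zero => simpa using hone
      | succ e ih => rw [pow_succ]; exact hmul _ _ _ _ ih (hlin i)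
    intro s
    induction s using Finsupp.induction_linear with
    | zero => simpa using hone
    | add f g hf hg =>
      rw [Finsupp.prod_add_index' (fun _ => pow_zero _) (fun _ _ _ => pow_add _ _ _), map_add]
      exact hmul _ _ _ _ hf hg
    | single i e =>
      rw [Finsupp.prod_single_index (h := fun i e => (Polynomial.C (uVar K n i) +
        Polynomial.X * Polynomial.C (vVar K n i)) ^ e) (pow_zero _), Finsupp.degree_single]
      exact hpow i e
  rw [restrictToLine, MvPolynomial.aeval_def, MvPolynomial.eval₂_eq', Polynomial.finsetSum_coeff]
  refine MvPolynomial.IsHomogeneous.sum _ _ _ fun s hs => ?_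
  have hdeg : s.degree = d := by
    have := hF (MvPolynomial.mem_support_iff.mp hs)
    rwa [Finsupp.degree_eq_weight_one]
  have h1 := key s k
  rw [hdeg, Finsupp.prod_fintype _ _ (fun _ => pow_zero _)] at h1
  have h2 : algebraMap K (Polynomial (PairRing K n)) (MvPolynomial.coeff s F) =
      Polynomial.C (MvPolynomial.C (MvPolynomial.coeff s F)) := rfl
  rw [h2, Polynomial.coeff_C_mul]
  exact h1.C_mul _

theorem contactIdeal_isHomogeneous (hF : F.IsHomogeneous d) (m : ℕ) :
    (contactIdeal F m).IsHomogeneous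
      (MvPolynomial.homogeneousSubmodule (Fin (n + 1) ⊕ Fin (n + 1)) K) := by
  refine Ideal.homogeneous_span _ _ ?_
  rintro _ ⟨k, _, rfl⟩
  exact ⟨d, restrictToLine_coeff_isHomogeneous F hF k⟩

theorem segrePlucker_isHomogeneous {k : ℕ}
    {p : MvPolynomial (Fin (n + 1) × Fin (n + 1) × Fin (n + 1)) K} (hp : p.IsHomogeneous k) :
    (segrePlucker K n p).IsHomogeneous (3 * k) := by
  refine hp.aeval _ fun a => ?_
  have hX : ∀ i, (MvPolynomial.X i : PairRing K n).IsHomogeneous 1 :=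
    fun i => MvPolynomial.isHomogeneous_X K i
  exact (hX _).mul (((hX _).mul (hX _)).sub ((hX _).mul (hX _)))

theorem contactSchemeIdeal_isHomogeneous (hF : F.IsHomogeneous d) (m : ℕ) :
    (contactSchemeIdeal F m).IsHomogeneous
      (MvPolynomial.homogeneousSubmodule (Fin (n + 1) × Fin (n + 1) × Fin (n + 1)) K) := by
  intro k p hp
  have hcomp : ∀ {τ : Type} (q : MvPolynomial τ K) (i : ℕ),
      (DirectSum.decompose (MvPolynomial.homogeneousSubmodule τ K) q i : MvPolynomial τ K) =
        MvPolynomial.homogeneousComponent i q :=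
    fun q i => MvPolynomial.decomposition.decompose'_apply q i
  rw [hcomp]
  change segrePlucker K n p ∈ contactIdeal F m at hp
  change segrePlucker K n _ ∈ contactIdeal F m
  have h := MvPolynomial.homogeneousComponent_mem_of_mem
    (contactIdeal_isHomogeneous F hF m) hp (3 * k)
  have h2 : MvPolynomial.homogeneousComponent (3 * k) (segrePlucker K n p) =
      segrePlucker K n (MvPolynomial.homogeneousComponent k p) := by
    conv_lhs => rw [← MvPolynomial.sum_homogeneousComponent p, map_sum, map_sum]
    have h3 : ∀ i ∈ Finset.range (p.totalDegree + 1),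
        MvPolynomial.homogeneousComponent (3 * k)
          (segrePlucker K n (MvPolynomial.homogeneousComponent i p)) =
        if i = k then segrePlucker K n (MvPolynomial.homogeneousComponent k p) else 0 := by
      intro i _
      rw [MvPolynomial.homogeneousComponent_of_mem (segrePlucker_isHomogeneous
        (MvPolynomial.homogeneousComponent_isHomogeneous i p))]
      by_cases hik : i = k
      · subst hik; simp
      · rw [if_neg (by omega), if_neg hik]
    rw [Finset.sum_congr rfl h3, Finset.sum_ite_eq']
    split_ifs with hk
    · rfl
    · rw [MvPolynomial.homogeneousComponent_eq_zero, map_zero]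
      simpa using hk
  rwa [h2] at h

/-- The scheme `Y_{F,m}` of pairs `(p, L)` of a point and a line in `ℙⁿ` with `p ∈ L` such that
`L` intersects `X_F` at `p` with multiplicity at least `m`. -/
def contactScheme (hF : F.IsHomogeneous d) (m : ℕ) : Scheme.{u} :=
  projQuot (contactSchemeIdeal F m) (contactSchemeIdeal_isHomogeneous F hF m)

/-- The structure morphism `Y_{F,m} ⟶ Spec K`. -/
def contactSchemeToSpec (hF : F.IsHomogeneous d) (m : ℕ) :
    contactScheme F hF m ⟶ Spec (CommRingCat.of K) :=
  projQuotToSpec (contactSchemeIdeal F m) (contactSchemeIdeal_isHomogeneous F hF m)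

end Contact

end PointLine

end

noncomputable section

namespace PointLine

universe u

attribute [local instance] MvPolynomial.gradedAlgebra

/-! ### Charts of closed subschemes of projective space -/

/-! Both schemes are studied on standard charts, each presented as an affine slice cut out by
explicit equations, and smoothness is tested on tangent spaces at points over an algebraic closure
`Ω` of `K`. The hypersurface is smooth of dimension `n - 1` exactly when `F` and its partials have
no common nonzero zero in `Ω`, so this condition has to be matched with smoothness of the contact
scheme. A chart of the latter lies in the affine space of dimension `2n + 2` with coordinates `u, v`
and has six equations: `f₀, f₁, f₂` and three normalizations. Its expected dimension is `2n - 4`.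

If `X_F` is singular at `u`, then `f₀(u, v) = f₁(u, v) = 0` for every `v`. The quadratic form `f₂(u,
·)` has a zero `v` in a two-dimensional space complementary to `u` in a plane section
(`exists_coeff_lineRestriction_eq_zero`). At this pair `df₀ = 0`, so the tangent space has dimension
at least `2n - 3` and the contact scheme is not smooth of dimension `2n - 4`
(`isNonsingular_of_contact_smooth`).

Conversely, a relation `∑ cₘ dfₘ = 0` at a contact pair gives two linear relations among the
coefficients of each quadratic polynomial `F_b(u + t v)`, where `F_b` is a partial of `F`. If `c₂ ≠
0`, they force all the `F_b` to vanish at one common point of the line, and Euler's formula `3F = ∑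
x_b F_b` makes it a singular point of `X_F`; this is where `3 ≠ 0` enters. If `c₂ = 0`,
nonsingularity at `u` kills `c₁` and `c₀` (`coeffs_eq_zero_of_isNonsingular`). The normalizations
stay independent of the `fₘ` because the `fₘ` are stationary along changes of the vectors
representing a flag. -/

theorem exists_away_ringEquiv {K A C : Type*} [CommRing K] [CommRing A] [CommRing C] [Algebra K A]
    (𝒜 : ℕ → Submodule K A) [GradedAlgebra 𝒜] {f : A} (hf : f ∈ 𝒜 1) (φ : A →+* C)
    (hφ : Function.Surjective φ) (hφf : φ f = 1)
    (hker : ∀ (n : ℕ) (x : A), x ∈ 𝒜 n → φ x = 0 → ∃ N : ℕ, f ^ N * x = 0) :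
    ∃ e : (HomogeneousLocalization.Away 𝒜 f) ≃+* C,
      ∀ c : 𝒜 0, e (HomogeneousLocalization.fromZeroRingHom 𝒜 (.powers f) c) = φ c := by
  let l : Localization.Away f →+* C :=
    IsLocalization.Away.lift f (g := φ) (by rw [hφf]; exact isUnit_one)
  let e₀ : HomogeneousLocalization.Away 𝒜 f →+* C := l.comp (algebraMap _ (Localization.Away f))
  have he₀ (n : ℕ) (x) (hx) : e₀ (HomogeneousLocalization.Away.mk 𝒜 hf n x hx) = φ x := by
    change l (HomogeneousLocalization.val (HomogeneousLocalization.Away.mk 𝒜 hf n x hx)) = _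
    rw [HomogeneousLocalization.Away.val_mk, Localization.mk_eq_mk']
    have h2 := congrArg l (IsLocalization.mk'_spec (Localization.Away f) x
      (⟨f ^ n, n, rfl⟩ : Submonoid.powers f))
    rw [map_mul, IsLocalization.Away.lift_eq, IsLocalization.Away.lift_eq, map_pow, hφf,
      one_pow, mul_one] at h2
    exact h2
  have hcst (c : 𝒜 0) : e₀ (HomogeneousLocalization.fromZeroRingHom 𝒜 (.powers f) c) = φ c := by
    change l (Localization.mk _ 1) = _
    rw [Localization.mk_one_eq_algebraMap, IsLocalization.Away.lift_eq]
  -- A fraction `p / fⁿ` goes to `φ p`, so `hker` says that a fraction in the kernel has a numerator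
  -- killed by a power of `f`.
  have hinj : Function.Injective e₀ := by
    rw [injective_iff_map_eq_zero]
    intro x hx
    obtain ⟨n, p, hp, rfl⟩ := HomogeneousLocalization.Away.mk_surjective _ hf x
    rw [he₀] at hx
    obtain ⟨N, hN⟩ := hker _ p hp hx
    refine HomogeneousLocalization.val_injective _ ?_
    rw [HomogeneousLocalization.Away.val_mk, HomogeneousLocalization.val_zero,
      Localization.mk_eq_mk', IsLocalization.mk'_eq_zero_iff]
    exact ⟨⟨f ^ N, N, rfl⟩, hN⟩
  -- Since `f` has degree one, a homogeneous `x` of degree `i` can be divided by `f ^ i` to reach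
  -- degree zero without changing its image.
  have hsurj : Function.Surjective e₀ := by
    intro y
    obtain ⟨x, rfl⟩ := hφ y
    change φ x ∈ e₀.range
    induction x using DirectSum.Decomposition.inductionOn 𝒜 with
    | zero => rw [map_zero]; exact zero_mem _
    | @homogeneous i m =>
      exact ⟨HomogeneousLocalization.Away.mk 𝒜 hf i m (by simp), he₀ _ _ _⟩
    | add m m' h h' => rw [map_add]; exact add_mem h h'
  exact ⟨RingEquiv.ofBijective e₀ ⟨hinj, hsurj⟩, hcst⟩

section Charts

variable {K : Type u} [Field K] {σ : Type} (I : Ideal (MvPolynomial σ K))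

theorem mk_X_mem_quotGrading (a : σ) :
    Ideal.Quotient.mk I (MvPolynomial.X a) ∈ quotGrading I 1 :=
  ⟨MvPolynomial.X a, MvPolynomial.isHomogeneous_X K a, rfl⟩

theorem irrelevant_le_span_X [GradedAlgebra (quotGrading I)] :
    (HomogeneousIdeal.irrelevant (quotGrading I)).toIdeal ≤
      Ideal.span (Set.range fun a : σ => Ideal.Quotient.mk I (MvPolynomial.X a)) := by
  refine HomogeneousIdeal.toIdeal_irrelevant_le _ |>.mpr ?_
  rintro i hi _ ⟨p, hp, rfl⟩
  have hp' : p ∈ Ideal.span (Set.range (MvPolynomial.X : σ → MvPolynomial σ K)) := by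
    rw [← Set.image_univ, MvPolynomial.mem_ideal_span_X_image]
    intro m hm
    have h1 := hp (MvPolynomial.mem_support_iff.mp hm)
    by_contra! hcon
    have : m = 0 := Finsupp.ext fun j => hcon j (Set.mem_univ j)
    rw [this, map_zero] at h1
    omega
  have := Ideal.mem_map_of_mem (Ideal.Quotient.mk I) hp'
  rw [Ideal.map_span, ← Set.range_comp] at this
  exact this

/-- The structure homomorphism from `K` to the coordinate ring of the chart `D₊(x_a)` of
`Proj (K[σ] / I)`. -/
def chartAlgebraMap [GradedAlgebra (quotGrading I)] (a : σ) :
    K →+* HomogeneousLocalization.Away (quotGrading I) (Ideal.Quotient.mk I (MvPolynomial.X a)) :=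
  (HomogeneousLocalization.fromZeroRingHom (quotGrading I) _).comp
    (algebraMap K (quotGrading I 0))

/-- The chart `D₊(x_a)` of `Proj (K[σ] / I)` is smooth over `K` of relative dimension `d`. -/
def ChartIsSmooth [GradedAlgebra (quotGrading I)] (d : ℕ) (a : σ) : Prop :=
  RingHom.Locally (RingHom.IsStandardSmoothOfRelativeDimension d) (chartAlgebraMap I a)

theorem smoothOfRelativeDimension_projQuotToSpec_iff
    (hI : I.IsHomogeneous (MvPolynomial.homogeneousSubmodule σ K)) (d : ℕ) :
    SmoothOfRelativeDimension d (projQuotToSpec I hI) ↔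
      ∀ a : σ, @ChartIsSmooth _ _ _ I (quotGradedAlgebra I hI) d a := by
  let := quotGradedAlgebra I hI
  let 𝒰 := Proj.affineOpenCoverOfIrrelevantLESpan (quotGrading I)
    (fun a : σ => Ideal.Quotient.mk I (MvPolynomial.X a)) (m := fun _ => 1)
    (fun a => mk_X_mem_quotGrading I a) (fun _ => Nat.one_pos) (irrelevant_le_span_X I)
  have : IsZariskiLocalAtSource (@SmoothOfRelativeDimension.{u} d) :=
    HasRingHomProperty.instIsZariskiLocalAtSource
      (Q := RingHom.Locally (RingHom.IsStandardSmoothOfRelativeDimension d))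
  refine (IsZariskiLocalAtSource.iff_of_openCover
    (P := @SmoothOfRelativeDimension d) 𝒰.openCover).trans ?_
  refine forall_congr' fun a => ?_
  have h : 𝒰.openCover.f a ≫ projQuotToSpec I hI =
      Spec.map (CommRingCat.ofHom (chartAlgebraMap I a)) := by
    change Proj.awayι (quotGrading I) _ (mk_X_mem_quotGrading I a) Nat.one_pos ≫
      Proj.toSpecZero (quotGrading I) ≫ _ = _
    rw [Proj.awayι_toSpecZero_assoc, ← Spec.map_comp]
    rfl
  rw [h]
  exact HasRingHomProperty.Spec_iff (P := @SmoothOfRelativeDimension d)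

theorem aeval_smul_of_isHomogeneous {R : Type*} [CommRing R] [Algebra K R]
    {p : MvPolynomial σ K} {k : ℕ} (hp : p.IsHomogeneous k) (c : R) (x : σ → R) :
    MvPolynomial.aeval (fun b => c * x b) p = c ^ k * MvPolynomial.aeval x p := by
  simp only [MvPolynomial.aeval_def, MvPolynomial.eval₂_eq, Finset.mul_sum]
  refine Finset.sum_congr rfl fun m hm => ?_
  have hk : ∑ i ∈ m.support, m i = k := by
    have := hp (MvPolynomial.mem_support_iff.mp hm)
    rwa [Pi.one_def, ← Finsupp.degree_eq_weight_one, Finsupp.degree_apply] at this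
  simp only [mul_pow, Finset.prod_mul_distrib, Finset.prod_pow_eq_pow_sum, hk]
  ring

/-- `J` defines a slice of the locus of `J₀` on which `x_a = 1`, and `ψ` moves a point of the locus
with `x_a ≠ 0` into that slice while dividing all coordinates `x_b` by `x_a`. If `p` is homogeneous
of degree `n` and vanishes on the slice, then `θ p = θ(x_a)ⁿ ψ(θ p)` lies in the localized `J₀`, so
a power of `x_a` times `p` lies in `I`. This is the kernel condition of `exists_away_ringEquiv`. -/
theorem exists_chart_ringEquiv [GradedAlgebra (quotGrading I)]
    {B : Type u} [CommRing B] [Algebra K B] (θ : MvPolynomial σ K →ₐ[K] B) (J₀ J : Ideal B)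
    (hθ : I = J₀.comap θ) (a : σ) (hJ₀ : J₀ ≤ J) (ha : θ (MvPolynomial.X a) - 1 ∈ J)
    (hsurj : ∀ b : B, ∃ p, θ p - b ∈ J)
    (ψ : B →ₐ[K] Localization.Away (θ (MvPolynomial.X a)))
    (hψ : ∀ b, algebraMap B _ (θ (MvPolynomial.X a)) * ψ (θ (MvPolynomial.X b)) =
      algebraMap B _ (θ (MvPolynomial.X b)))
    (hψJ : ∀ b ∈ J, ψ b ∈ J₀.map (algebraMap B (Localization.Away (θ (MvPolynomial.X a))))) :
    ∃ e : HomogeneousLocalization.Away (quotGrading I) (Ideal.Quotient.mk I (MvPolynomial.X a)) ≃+*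
      (B ⧸ J), (e : _ →+* _).comp (chartAlgebraMap I a) = algebraMap K (B ⧸ J) := by
  let φ : MvPolynomial σ K ⧸ I →+* B ⧸ J := Ideal.Quotient.lift I
    ((Ideal.Quotient.mk J).comp (θ : MvPolynomial σ K →+* B)) fun p hp => by
      rw [hθ] at hp
      exact Ideal.Quotient.eq_zero_iff_mem.mpr (hJ₀ hp)
  have hker : ∀ (n : ℕ) (x : MvPolynomial σ K ⧸ I), x ∈ quotGrading I n → φ x = 0 →
      ∃ N : ℕ, Ideal.Quotient.mk I (MvPolynomial.X a) ^ N * x = 0 := by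
    rintro n _ ⟨p, hp, rfl⟩ hx
    have hpJ : θ p ∈ J := Ideal.Quotient.eq_zero_iff_mem.mp hx
    have hpJ₀ := hψJ _ hpJ
    have hp' : algebraMap B (Localization.Away (θ (MvPolynomial.X a))) (θ p) =
        algebraMap B _ (θ (MvPolynomial.X a)) ^ n * ψ (θ p) := by
      have h1 : (IsScalarTower.toAlgHom K B (Localization.Away (θ (MvPolynomial.X a)))).comp θ =
          MvPolynomial.aeval fun b =>
            algebraMap B _ (θ (MvPolynomial.X a)) * ψ (θ (MvPolynomial.X b)) :=
        MvPolynomial.algHom_ext fun b => by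
          rw [MvPolynomial.aeval_X, hψ]
          rfl
      have h2 : ψ.comp θ = MvPolynomial.aeval fun b => ψ (θ (MvPolynomial.X b)) :=
        MvPolynomial.algHom_ext fun b => by
          rw [MvPolynomial.aeval_X]
          rfl
      have h3 := aeval_smul_of_isHomogeneous hp
        (algebraMap B (Localization.Away (θ (MvPolynomial.X a))) (θ (MvPolynomial.X a)))
        fun b => ψ (θ (MvPolynomial.X b))
      rw [← h1, ← h2] at h3
      exact h3
    have hmem : algebraMap B (Localization.Away (θ (MvPolynomial.X a))) (θ p) ∈
        J₀.map (algebraMap B (Localization.Away (θ (MvPolynomial.X a)))) := by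
      rw [hp']
      exact Ideal.mul_mem_left _ _ hpJ₀
    rw [IsLocalization.algebraMap_mem_map_algebraMap_iff
      (Submonoid.powers (θ (MvPolynomial.X a)))] at hmem
    obtain ⟨_, ⟨N, rfl⟩, hN⟩ := hmem
    refine ⟨N, ?_⟩
    have hNI : MvPolynomial.X a ^ N * p ∈ I := by
      rw [hθ, Ideal.mem_comap, map_mul, map_pow]
      exact hN
    rw [← map_pow]
    exact Ideal.Quotient.eq_zero_iff_mem.mpr hNI
  obtain ⟨e, he⟩ := exists_away_ringEquiv (quotGrading I) (mk_X_mem_quotGrading I a) φ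
    (fun y => by
      obtain ⟨b, rfl⟩ := Ideal.Quotient.mk_surjective y
      obtain ⟨p, hp⟩ := hsurj b
      exact ⟨Ideal.Quotient.mk I p, Ideal.Quotient.eq.mpr hp⟩)
    (Ideal.Quotient.eq.mpr ha) hker
  refine ⟨e, RingHom.ext fun c => (he _).trans ?_⟩
  change Ideal.Quotient.mk J (θ (algebraMap K _ c)) = _
  rw [θ.commutes]
  rfl

/-- The chart `D₊(x_a)` is smooth if and only if the slice `B ⧸ J` is. -/
theorem chartIsSmooth_iff [GradedAlgebra (quotGrading I)]
    {B : Type u} [CommRing B] [Algebra K B] (θ : MvPolynomial σ K →ₐ[K] B) (J₀ J : Ideal B)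
    (hθ : I = J₀.comap θ) (a : σ) (hJ₀ : J₀ ≤ J) (ha : θ (MvPolynomial.X a) - 1 ∈ J)
    (hsurj : ∀ b : B, ∃ p, θ p - b ∈ J)
    (ψ : B →ₐ[K] Localization.Away (θ (MvPolynomial.X a)))
    (hψ : ∀ b, algebraMap B _ (θ (MvPolynomial.X a)) * ψ (θ (MvPolynomial.X b)) =
      algebraMap B _ (θ (MvPolynomial.X b)))
    (hψJ : ∀ b ∈ J, ψ b ∈ J₀.map (algebraMap B (Localization.Away (θ (MvPolynomial.X a)))))
    (d : ℕ) :
    ChartIsSmooth I d a ↔ RingHom.Locally (RingHom.IsStandardSmoothOfRelativeDimension d)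
      (algebraMap K (B ⧸ J)) := by
  obtain ⟨e, he⟩ := exists_chart_ringEquiv I θ J₀ J hθ a hJ₀ ha hsurj ψ hψ hψJ
  have h := RingHom.locally_respectsIso
    (RingHom.isStandardSmoothOfRelativeDimension_respectsIso (n := d))
  refine ⟨fun H => ?_, fun H => ?_⟩
  · rw [← he]
    exact h.1 _ e H
  · have h2 : (e.symm : _ →+* _).comp (algebraMap K (B ⧸ J)) = chartAlgebraMap I a := by
      rw [← he]
      exact RingHom.ext fun c => e.symm_apply_apply _
    rw [ChartIsSmooth, ← h2]
    exact h.1 _ e.symm H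

end Charts

open MvPolynomial

/-! ### The Jacobian criterion -/

section Jacobian

/-- Taylor's formula to first order. -/
theorem aeval_add_mul_of_sq_eq_zero {K R τ : Type*} [CommRing K] [CommRing R] [Algebra K R]
    [Fintype τ] (w c : τ → R) {e : R} (he : e * e = 0) (p : MvPolynomial τ K) :
    aeval (fun b => w b + e * c b) p =
      aeval w p + e * ∑ b, aeval w (pderiv b p) * c b := by
  classical
  induction p using MvPolynomial.induction_on with
  | C k => simp
  | add p q hp hq =>
    simp only [map_add, hp, hq, add_mul, Finset.sum_add_distrib]
    ring
  | mul_X p i hp =>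
    have h : ∑ b, aeval w (pderiv b (p * X i)) * c b =
        (∑ b, aeval w (pderiv b p) * c b) * w i + aeval w p * c i := by
      simp only [Derivation.leibniz, smul_eq_mul, map_add, map_mul, pderiv_X, aeval_X, add_mul,
        Finset.sum_add_distrib, Finset.sum_mul]
      rw [add_comm]
      congr 1
      · exact Finset.sum_congr rfl fun b _ => by ring
      · rw [Finset.sum_eq_single i]
        · simp
        · intro b _ hb
          simp [hb.symm]
        · simp
    rw [map_mul, map_mul, hp, aeval_X, aeval_X, h]
    linear_combination (∑ b, aeval w (pderiv b p) * c b) * c i * he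

variable {K Ω : Type u} [Field K] [Field Ω] [Algebra K Ω]

/-- The tangent vector `a` at the point `x`, as a homomorphism to the dual numbers. -/
def tangentHom (K : Type u) [Field K] [Algebra K Ω] {τ : Type} (x a : τ → Ω) :
    MvPolynomial τ K →ₐ[K] DualNumber Ω :=
  aeval fun b => TrivSqZeroExt.inl (x b) + TrivSqZeroExt.inr (a b)

theorem tangentHom_apply {τ : Type} [Fintype τ] (x a : τ → Ω) (p : MvPolynomial τ K) :
    tangentHom K x a p = TrivSqZeroExt.inl (aeval x p) +
      TrivSqZeroExt.inr (∑ b, aeval x (pderiv b p) * a b) := by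
  have h (q : MvPolynomial τ K) : aeval (fun b => (TrivSqZeroExt.inl (x b) : DualNumber Ω)) q =
      TrivSqZeroExt.inl (aeval x q) := by
    have : aeval (fun b => (TrivSqZeroExt.inl (x b) : DualNumber Ω)) =
        ((TrivSqZeroExt.inlAlgHom Ω Ω Ω).restrictScalars K).comp (aeval (R := K) x) :=
      algHom_ext fun b => by simp
    rw [this]
    rfl
  have h2 := aeval_add_mul_of_sq_eq_zero (K := K)
    (fun b => (TrivSqZeroExt.inl (x b) : DualNumber Ω)) (fun b => TrivSqZeroExt.inl (a b))
    (e := DualNumber.eps) DualNumber.eps_mul_eps p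
  have h3 (b) : (DualNumber.eps * TrivSqZeroExt.inl b : DualNumber Ω) = TrivSqZeroExt.inr b := by
    ext <;> simp
  simp only [h3, h, ← TrivSqZeroExt.inl_mul] at h2
  rw [tangentHom, h2, ← h3]
  congr 2
  exact (map_sum (TrivSqZeroExt.inlHom Ω Ω) _ _).symm

/-- Row rank equals column rank: the columns span, and a basis extracted from them gives a nonzero
maximal minor. -/
theorem exists_injective_det_ne_zero {ι τ : Type} [Fintype ι] [DecidableEq ι] [Finite τ]
    {M : ι → τ → Ω} (hM : LinearIndependent Ω M) :
    ∃ a : ι → τ, Function.Injective a ∧ (Matrix.of fun i j => M j (a i)).det ≠ 0 := by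
  have := Fintype.ofFinite τ
  obtain ⟨κ, a, ha, hsp, hli⟩ := exists_linearIndependent' Ω fun (b : τ) (j : ι) => M j b
  have := Fintype.ofInjective a ha
  have htop : Submodule.span Ω (Set.range fun (b : τ) (j : ι) => M j b) = ⊤ := by
    refine Submodule.eq_top_of_finrank_eq ?_
    have h1 := LinearIndependent.rank_matrix (M := Matrix.of M) hM
    rw [Matrix.rank_eq_finrank_span_cols] at h1
    rw [Module.finrank_fintype_fun_eq_card, ← h1]
    rfl
  have hcard : Fintype.card κ = Fintype.card ι := by
    rw [← Module.finrank_eq_card_basis (Module.Basis.mk hli (hsp.trans htop).ge),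
      Module.finrank_fintype_fun_eq_card]
  let e := Fintype.equivOfCardEq hcard
  refine ⟨a ∘ e.symm, ha.comp e.symm.injective, ?_⟩
  have := hli.comp e.symm e.symm.injective
  exact (Matrix.linearIndependent_rows_iff_isUnit.mp this).map Matrix.detMonoidHom |>.ne_zero

variable {ι τ : Type} [Fintype τ] (g : ι → MvPolynomial τ K)

/-- An affine scheme is smooth of the expected dimension if the differentials of its equations are
linearly independent at all geometric points. -/
theorem locally_isStandardSmooth_of_linearIndependent [Fintype ι] [IsAlgClosed Ω]
    (h : ∀ x : τ → Ω, (∀ j, aeval x (g j) = 0) →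
      LinearIndependent Ω fun j b => aeval x (pderiv b (g j))) :
    RingHom.Locally (RingHom.IsStandardSmoothOfRelativeDimension
        (Fintype.card τ - Fintype.card ι))
      (algebraMap K (MvPolynomial τ K ⧸ Ideal.span (Set.range g))) := by
  classical
  let m : {a : ι → τ // Function.Injective a} → MvPolynomial τ K :=
    fun a => (Matrix.of fun i j => pderiv (a.1 i) (g j)).det
  -- By the Nullstellensatz over `Ω`, the equations and the maximal minors of their Jacobian matrix
  -- generate the unit ideal, having no common zero. Hence the loci where some minor is invertible
  -- cover the scheme.
  have hspan : Ideal.span (Set.range g) ⊔ Ideal.span (Set.range m) = ⊤ := by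
    rw [← Ideal.radical_eq_top, ← vanishingIdeal_zeroLocus_eq_radical (K := Ω),
      eq_top_iff]
    rintro p - x hx
    exfalso
    have hg : ∀ j, aeval x (g j) = 0 := fun j =>
      hx _ (Ideal.mem_sup_left (Ideal.subset_span ⟨j, rfl⟩))
    obtain ⟨a, ha, hdet⟩ := exists_injective_det_ne_zero (h x hg)
    apply hdet
    have := hx _ (Ideal.mem_sup_right (Ideal.subset_span ⟨⟨a, ha⟩, rfl⟩))
    rw [AlgHom.map_det] at this
    exact this
  refine ⟨Set.range fun a => Ideal.Quotient.mk _ (m a), ?_, ?_⟩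
  · have h2 := congrArg (Ideal.map (Ideal.Quotient.mk (Ideal.span (Set.range g)))) hspan
    rw [Ideal.map_sup, Ideal.map_quotient_self, bot_sup_eq, Ideal.map_top, Ideal.map_span,
      ← Set.range_comp] at h2
    exact h2
  · rintro _ ⟨a, rfl⟩
    rw [← IsScalarTower.algebraMap_eq, RingHom.isStandardSmoothOfRelativeDimension_algebraMap]
    let P := Algebra.PreSubmersivePresentation.naive (R := K) (v := g) a.1 a.2
    let Q := Algebra.SubmersivePresentation.localizationAway
      (Localization.Away (Ideal.Quotient.mk (Ideal.span (Set.range g)) (m a)))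
      (Ideal.Quotient.mk (Ideal.span (Set.range g)) (m a))
    have hP : P.jacobian = Ideal.Quotient.mk (Ideal.span (Set.range g)) (m a) := by
      rw [Algebra.PreSubmersivePresentation.jacobian_eq_jacobiMatrix_det]
      have h1 : P.jacobiMatrix = Matrix.of fun i j => pderiv (a.1 i) (g j) := by
        ext i j : 1
        exact Algebra.PreSubmersivePresentation.jacobiMatrix_naive _ _ _ _ i j
      have h2 : aeval P.val = Ideal.Quotient.mkₐ K (Ideal.span (Set.range g)) :=
        algHom_ext fun b => by
          rw [aeval_X]
          rfl
      rw [h1, Algebra.Generators.algebraMap_apply, h2]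
      rfl
    -- Inverting the chosen minor, which is the Jacobian of `P`, turns the naive presentation into a
    -- submersive one. The extra variable and the extra equation of the localization leave the
    -- dimension unchanged.
    let PQ : Algebra.SubmersivePresentation K
        (Localization.Away (Ideal.Quotient.mk (Ideal.span (Set.range g)) (m a)))
        (Unit ⊕ τ) (Unit ⊕ ι) :=
      { Q.toPreSubmersivePresentation.comp P with
        jacobian_isUnit := by
          rw [Algebra.PreSubmersivePresentation.comp_jacobian_eq_jacobian_smul_jacobian, hP,
            Algebra.smul_def]
          exact (IsLocalization.Away.algebraMap_isUnit _).mul Q.jacobian_isUnit }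
    refine PQ.isStandardSmoothOfRelativeDimension ?_
    change (Q.toPreSubmersivePresentation.comp P).dimension = _
    rw [Algebra.PreSubmersivePresentation.dimension_comp_eq_dimension_add_dimension]
    simp [Algebra.Presentation.dimension]

/-- The tangent spaces at geometric points of a smooth affine scheme of relative dimension `d` have
dimension at most `d`. -/
theorem finrank_tangent_le_of_locally {d : ℕ}
    (h : RingHom.Locally (RingHom.IsStandardSmoothOfRelativeDimension d)
      (algebraMap K (MvPolynomial τ K ⧸ Ideal.span (Set.range g))))
    (x : τ → Ω) (hx : ∀ j, aeval x (g j) = 0) (V : Submodule Ω (τ → Ω))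
    (hV : ∀ a ∈ V, ∀ j, ∑ b, aeval x (pderiv b (g j)) * a b = 0) :
    Module.finrank Ω V ≤ d := by
  obtain ⟨s, hs, hsm⟩ := h
  let lift {A : Type u} [CommRing A] [Algebra K A] (f : MvPolynomial τ K →ₐ[K] A)
      (hf : ∀ j, f (g j) = 0) : (MvPolynomial τ K ⧸ Ideal.span (Set.range g)) →ₐ[K] A :=
    Ideal.Quotient.liftₐ _ f fun p hp => by
      have : Ideal.span (Set.range g) ≤ RingHom.ker f := by
        rw [Ideal.span_le]
        rintro _ ⟨j, rfl⟩
        exact hf j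
      exact this hp
  let ev := lift (aeval x) hx
  -- Choose a standard smooth piece containing the point `x`.
  obtain ⟨t, hts, ht⟩ : ∃ t ∈ s, ev t ≠ 0 := by
    by_contra! hcon
    have : Ideal.span s ≤ RingHom.ker ev := Ideal.span_le.mpr hcon
    rw [hs] at this
    exact one_ne_zero ((map_one ev).symm.trans (this (x := 1) trivial))
  have hsm := hsm t hts
  rw [← IsScalarTower.algebraMap_eq, RingHom.isStandardSmoothOfRelativeDimension_algebraMap] at hsm
  obtain ⟨ι', σ', _, _, P, hP⟩ := hsm
  let ev' : Localization.Away t →ₐ[K] Ω := IsLocalization.liftAlgHom (M := .powers t) (f := ev)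
    (by
      rintro ⟨_, n, rfl⟩
      simpa using (isUnit_iff_ne_zero.mpr ht).pow n)
  let : Algebra (Localization.Away t) Ω := ev'.toRingHom.toAlgebra
  have : IsScalarTower K (Localization.Away t) Ω :=
    IsScalarTower.of_algebraMap_eq fun c => (ev'.commutes c).symm
  -- The Kähler differentials of a standard smooth algebra have a basis indexed by the variables
  -- outside the range of `P.map`, so an `Ω`-valued derivation is determined by its `d` values
  -- there.
  let Φ : Derivation K (Localization.Away t) Ω →ₗ[Ω] (((Set.range P.map)ᶜ : Set ι') → Ω) :=
    { toFun := fun D k => D (P.val k)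
      map_add' := fun _ _ => rfl
      map_smul' := fun _ _ => rfl }
  have hΦ : Function.Injective Φ := by
    rw [injective_iff_map_eq_zero]
    intro D hD
    have : D.liftKaehlerDifferential = 0 := P.basisKaehler.ext fun k => by
      rw [P.basisKaehler_apply, Derivation.liftKaehlerDifferential_comp_D]
      exact congrFun hD k
    ext y
    rw [← Derivation.liftKaehlerDifferential_comp_D, this]
    rfl
  let Ψ : Derivation K (Localization.Away t) Ω →ₗ[Ω] (τ → Ω) :=
    { toFun := fun D b => D (algebraMap _ _ (Ideal.Quotient.mk (Ideal.span (Set.range g)) (X b)))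
      map_add' := fun _ _ => rfl
      map_smul' := fun _ _ => rfl }
  -- A tangent vector is a homomorphism to the dual numbers. It extends to the localization because
  -- `t` is a unit at `x`, and its `ε`-component is a derivation.
  have hVΨ : V ≤ LinearMap.range Ψ := by
    intro a ha
    let E := lift (tangentHom K x a) fun j => by
      rw [tangentHom_apply, hx, hV a ha]
      simp
    have hE : ∀ y, (E y).fst = ev y := by
      intro y
      obtain ⟨p, rfl⟩ := Ideal.Quotient.mk_surjective y
      change (tangentHom K x a p).fst = aeval x p
      rw [tangentHom_apply]
      simp
    let E' : Localization.Away t →ₐ[K] DualNumber Ω :=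
      IsLocalization.liftAlgHom (M := .powers t) (f := E)
        (by
          rintro ⟨_, n, rfl⟩
          rw [TrivSqZeroExt.isUnit_iff_isUnit_fst]
          change IsUnit (E (t ^ n)).fst
          rw [hE, map_pow]
          exact (isUnit_iff_ne_zero.mpr ht).pow n)
    have hE' : ∀ y, (E' y).fst = ev' y := by
      have : ((TrivSqZeroExt.fstHom K Ω Ω).comp E') = ev' := by
        refine IsLocalization.algHom_ext (.powers t) ?_
        ext y
        have h1 : E' (algebraMap _ _ y) = E y := IsLocalization.lift_eq _ y
        have h2 : ev' (algebraMap _ _ y) = ev y := IsLocalization.lift_eq _ y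
        change (E' (algebraMap _ _ y)).fst = ev' (algebraMap _ _ y)
        rw [h1, h2, hE]
      exact fun y => DFunLike.congr_fun this y
    let D : Derivation K (Localization.Away t) Ω := Derivation.mk'
      ((TrivSqZeroExt.sndHom Ω Ω).restrictScalars K ∘ₗ E'.toLinearMap) fun y z => by
        have hsm (y : Localization.Away t) (c : Ω) : y • c = ev' y * c := rfl
        change (E' (y * z)).snd = y • (E' z).snd + z • (E' y).snd
        rw [map_mul, TrivSqZeroExt.snd_mul, hE', hE', hsm, hsm, smul_eq_mul,
          op_smul_eq_smul, smul_eq_mul]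
    refine ⟨D, funext fun b => ?_⟩
    change (E' (algebraMap _ _ (Ideal.Quotient.mk (Ideal.span (Set.range g)) (X b)))).snd = _
    have h1 (y) : E' (algebraMap _ _ y) = E y := IsLocalization.lift_eq _ y
    rw [h1]
    change (tangentHom K x a (X b)).snd = _
    rw [tangentHom, aeval_X]
    simp
  calc Module.finrank Ω V ≤ Module.finrank Ω (LinearMap.range Ψ) := Submodule.finrank_mono hVΨ
    _ ≤ Module.finrank Ω (Derivation K (Localization.Away t) Ω) :=
      have := Module.Finite.of_injective Φ hΦ
      LinearMap.finrank_range_le Ψ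
    _ ≤ Module.finrank Ω (((Set.range P.map)ᶜ : Set ι') → Ω) :=
      LinearMap.finrank_le_finrank_of_injective hΦ
    _ = d := by
      have := Fintype.ofFinite ι'
      classical
      have := Fintype.ofFinite σ'
      rw [Module.finrank_fintype_fun_eq_card, ← hP, Fintype.card_compl_set,
        Set.card_range_of_injective P.map_inj]
      simp [Algebra.Presentation.dimension]

end Jacobian

/-! ### Linear algebra of tangent vectors -/

section TangentVectors

variable {K Ω : Type u} [Field K] [Field Ω] [Algebra K Ω] {ι τ : Type} [Fintype ι] [Fintype τ]

theorem snd_tangentHom (x a : τ → Ω) (p : MvPolynomial τ K) :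
    (tangentHom K x a p).snd = ∑ b, aeval x (pderiv b p) * a b := by
  rw [tangentHom_apply]
  simp

theorem linearIndependent_of_forall_tangent (g : ι → MvPolynomial τ K) (x : τ → Ω)
    (h : ∀ c : ι → Ω, (∀ a, ∑ j, c j * (tangentHom K x a (g j)).snd = 0) → ∀ j, c j = 0) :
    LinearIndependent Ω fun j b => aeval x (pderiv b (g j)) := by
  rw [Fintype.linearIndependent_iff]
  intro c hc
  refine h c fun a => ?_
  simp only [snd_tangentHom, Finset.mul_sum]
  rw [Finset.sum_comm]
  refine Finset.sum_eq_zero fun b _ => ?_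
  have := congrFun hc b
  simp only [Finset.sum_apply, Pi.smul_apply, smul_eq_mul, Pi.zero_apply] at this
  simp only [← mul_assoc, ← Finset.sum_mul, this, zero_mul]

theorem card_sub_card_le_finrank_ker {κ : Type} [Fintype κ] (l : (τ → Ω) →ₗ[Ω] (κ → Ω)) :
    Fintype.card τ - Fintype.card κ ≤ Module.finrank Ω (LinearMap.ker l) := by
  have h1 := LinearMap.finrank_range_add_finrank_ker l
  have h2 := Submodule.finrank_le (LinearMap.range l)
  rw [Module.finrank_fintype_fun_eq_card] at h1 h2
  omega

end TangentVectors

/-! ### Smoothness of hypersurfaces -/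

section Hypersurface

variable {K : Type u} [Field K] {n d : ℕ} (F : MvPolynomial (Fin (n + 1)) K)

/-- The only common zero of `F` and its partial derivatives with coordinates in `Ω` is `0`. -/
def IsNonsingular (Ω : Type u) [Field Ω] [Algebra K Ω] : Prop :=
  ∀ x : Fin (n + 1) → Ω, aeval x F = 0 → (∀ i, aeval x (pderiv i F) = 0) → x = 0

/-- The equations of the chart `x_a ≠ 0` of the hypersurface `F = 0`, as a closed subscheme of the
affine space `𝔸ⁿ⁺¹`. -/
def hypersurfaceChartEquations (a : Fin (n + 1)) : Fin 2 → MvPolynomial (Fin (n + 1)) K :=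
  ![F, X a - 1]

theorem hypersurface_chartIsSmooth_iff (hF : F.IsHomogeneous d) (a : Fin (n + 1)) (e : ℕ) :
    @ChartIsSmooth _ _ _ (Ideal.span {F})
        (quotGradedAlgebra _ (hypersurfaceIdeal_isHomogeneous F hF)) e a ↔
      RingHom.Locally (RingHom.IsStandardSmoothOfRelativeDimension e)
        (algebraMap K (MvPolynomial (Fin (n + 1)) K ⧸
          Ideal.span (Set.range (hypersurfaceChartEquations F a)))) := by
  let := quotGradedAlgebra _ (hypersurfaceIdeal_isHomogeneous F hF)
  let L := Localization.Away (AlgHom.id K _ (X a : MvPolynomial (Fin (n + 1)) K))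
  let c : L := IsLocalization.Away.invSelf (AlgHom.id K _ (X a : MvPolynomial (Fin (n + 1)) K))
  have hc : algebraMap _ L (X a) * c = 1 :=
    IsLocalization.Away.mul_invSelf (AlgHom.id K _ (X a : MvPolynomial (Fin (n + 1)) K))
  -- The normalization `x ↦ x / x_a`.
  let ψ : MvPolynomial (Fin (n + 1)) K →ₐ[K] L := aeval fun b => c * algebraMap (MvPolynomial (Fin (n + 1)) K) L (X b)
  refine chartIsSmooth_iff (Ideal.span {F}) (AlgHom.id K _) (Ideal.span {F}) _ rfl a ?_ ?_ ?_ ψ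
    ?_ ?_ e
  · rw [Ideal.span_singleton_le_iff_mem]
    exact Ideal.subset_span ⟨0, rfl⟩
  · exact Ideal.subset_span ⟨1, rfl⟩
  · intro b
    exact ⟨b, by simp⟩
  · intro b
    change algebraMap _ L (X a) * ψ (X b) = algebraMap _ L (X b)
    rw [aeval_X, ← mul_assoc, hc, one_mul]
  · suffices h : Ideal.span (Set.range (hypersurfaceChartEquations F a)) ≤
        ((Ideal.span {F}).map (algebraMap _ L)).comap ψ from fun b hb => h hb
    rw [Ideal.span_le]
    rintro _ ⟨j, rfl⟩
    fin_cases j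
    · change ψ F ∈ (Ideal.span {F}).map (algebraMap _ L)
      have h1 : aeval (fun b => algebraMap (MvPolynomial (Fin (n + 1)) K) L (X b)) F = algebraMap _ L F := by
        have : aeval (fun b => algebraMap (MvPolynomial (Fin (n + 1)) K) L (X b)) = IsScalarTower.toAlgHom K
            (MvPolynomial (Fin (n + 1)) K) L := algHom_ext fun b => by
          rw [aeval_X]
          rfl
        rw [this]
        rfl
      rw [aeval_smul_of_isHomogeneous hF, h1]
      exact Ideal.mul_mem_left _ _ (Ideal.mem_map_of_mem _ (Ideal.mem_span_singleton_self F))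
    · change ψ (X a - 1) ∈ (Ideal.span {F}).map (algebraMap _ L)
      rw [map_sub, map_one, aeval_X, mul_comm, hc, sub_self]
      exact zero_mem _

theorem smoothOfRelativeDimension_hypersurfaceToSpec_iff (Ω : Type u) [Field Ω] [Algebra K Ω]
    [IsAlgClosed Ω] (hn : 1 ≤ n) (hF : F.IsHomogeneous d) :
    SmoothOfRelativeDimension (n - 1) (hypersurfaceToSpec F hF) ↔ IsNonsingular F Ω := by
  refine (smoothOfRelativeDimension_projQuotToSpec_iff _ _ _).trans
    ((forall_congr' fun a => hypersurface_chartIsSmooth_iff F hF a _).trans ?_)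
  constructor
  · intro h x hx hdx
    by_contra hx0
    obtain ⟨a, ha⟩ := Function.ne_iff.mp hx0
    let y : Fin (n + 1) → Ω := fun b => (x a)⁻¹ * x b
    have hya : y a = 1 := inv_mul_cancel₀ ha
    have hdy (i) : aeval y (pderiv i F) = 0 := by
      rw [aeval_smul_of_isHomogeneous (hF.pderiv (i := i)), hdx, mul_zero]
    -- At a singular point `dF = 0`, so only `v a = 0` constrains tangent vectors. They form a space
    -- of dimension `n`, more than `n - 1`.
    have h1 := finrank_tangent_le_of_locally (hypersurfaceChartEquations F a) (h a) y
      (by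
        intro j
        fin_cases j
        · change aeval y F = 0
          rw [aeval_smul_of_isHomogeneous hF, hx, mul_zero]
        · change aeval y (X a - 1) = 0
          simp [hya])
      (LinearMap.ker (LinearMap.pi fun _ : Fin 1 => LinearMap.proj a))
      (by
        intro v hv j
        have hv : v a = 0 := congrFun hv 0
        rw [← snd_tangentHom]
        fin_cases j
        · change (tangentHom K y v F).snd = 0
          simp [snd_tangentHom, hdy]
        · change (tangentHom K y v (X a - 1)).snd = 0
          simp [tangentHom, hv])
    have h2 := card_sub_card_le_finrank_ker
      (LinearMap.pi fun _ : Fin 1 => (LinearMap.proj a : (Fin (n + 1) → Ω) →ₗ[Ω] Ω))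
    simp only [Fintype.card_fin] at h2
    omega
  · intro h a
    have := locally_isStandardSmooth_of_linearIndependent (Ω := Ω)
      (hypersurfaceChartEquations F a) fun x hx => by
        have hxF : aeval x F = 0 := hx 0
        have hxa : x a = 1 := by
          have : aeval x (X a - 1 : MvPolynomial (Fin (n + 1)) K) = 0 := hx 1
          simpa [sub_eq_zero] using this
        refine linearIndependent_of_forall_tangent _ x fun c hc => ?_
        have hc (v) : c 0 * (tangentHom K x v F).snd + c 1 * v a = 0 := by
          have := hc v
          rw [Fin.sum_univ_two] at this
          change c 0 * (tangentHom K x v F).snd + c 1 * (tangentHom K x v (X a - 1)).snd = 0 at this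
          rw [← this]
          simp [tangentHom]
        have h1 : c 1 = 0 := by
          -- The radial direction is tangent to the cone: `F((1 + ε) x) = (1 + ε)ᵈ F(x) = 0`. Since
          -- `x a = 1`, the relation in this direction isolates `c 1`.
          have h2 : tangentHom K x x F = 0 := by
            have : (fun b => TrivSqZeroExt.inl (x b) + TrivSqZeroExt.inr (x b) : _ → DualNumber Ω) =
                fun b => (1 + DualNumber.eps) * TrivSqZeroExt.inl (x b) := by
              funext b
              ext <;> simp
            rw [tangentHom, this, aeval_smul_of_isHomogeneous hF]
            have h3 := tangentHom_apply (K := K) x 0 F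
            simp only [tangentHom, Pi.zero_apply, TrivSqZeroExt.inr_zero, add_zero, mul_zero,
              Finset.sum_const_zero, hxF, TrivSqZeroExt.inl_zero] at h3
            rw [h3, mul_zero]
          have := hc x
          simpa [h2, hxa] using this
        have h0 : c 0 = 0 := by
          by_contra hc0
          have hx0 := h x hxF fun i => by
            have := hc (Pi.single i 1)
            rw [h1, zero_mul, add_zero, mul_eq_zero, or_iff_right hc0, snd_tangentHom] at this
            simpa [Pi.single_apply] using this
          rw [hx0] at hxa
          exact zero_ne_one hxa
        exact Fin.forall_fin_two.mpr ⟨h0, h1⟩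
    simpa using this

end Hypersurface

/-! ### Restriction of a form to a line -/

section LineRestriction

variable {K : Type u} [Field K] {n d : ℕ} (F : MvPolynomial (Fin (n + 1)) K)

/-- The restriction `F(x + t y)` of `F` to the line through `x` and `y`, as a polynomial in `t`. -/
def lineRestriction {R : Type*} [CommRing R] [Algebra K R] (x y : Fin (n + 1) → R) :
    Polynomial R :=
  aeval (fun i => Polynomial.C (x i) + Polynomial.X * Polynomial.C (y i)) F

variable {R : Type*} [CommRing R] [Algebra K R]

theorem map_lineRestriction {S : Type*} [CommRing S] [Algebra K S] (f : R →ₐ[K] S)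
    (x y : Fin (n + 1) → R) :
    (lineRestriction F x y).map (f : R →+* S) = lineRestriction F (f ∘ x) (f ∘ y) := by
  have h : (Polynomial.mapAlgHom f).comp
      (aeval fun i => Polynomial.C (x i) + Polynomial.X * Polynomial.C (y i)) =
      aeval fun i => Polynomial.C (f (x i)) + Polynomial.X * Polynomial.C (f (y i)) :=
    algHom_ext fun i => by simp
  exact DFunLike.congr_fun h F

theorem aeval_lineRestriction {A : Type*} [CommRing A] [Algebra K A] [Algebra R A]
    [IsScalarTower K R A] (T : A) (x y : Fin (n + 1) → R) :
    Polynomial.aeval T (lineRestriction F x y) =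
      aeval (fun i => algebraMap R A (x i) + T * algebraMap R A (y i)) F := by
  have h : ((Polynomial.aeval T).restrictScalars K).comp
      (aeval fun i => Polynomial.C (x i) + Polynomial.X * Polynomial.C (y i)) =
      aeval fun i => algebraMap R A (x i) + T * algebraMap R A (y i) :=
    algHom_ext fun i => by
      simp only [AlgHom.comp_apply, aeval_X, AlgHom.restrictScalars_apply, map_add, map_mul,
        Polynomial.aeval_X, Polynomial.aeval_C]
  exact DFunLike.congr_fun h F

theorem lineRestriction_coeff_zero (x y : Fin (n + 1) → R) :
    (lineRestriction F x y).coeff 0 = aeval x F := by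
  rw [Polynomial.coeff_zero_eq_aeval_zero, aeval_lineRestriction]
  simp

/-- The order of contact does not depend on the vectors chosen to represent the point and the
line. -/
theorem X_pow_dvd_lineRestriction (hF : F.IsHomogeneous d) {m : ℕ} {x y : Fin (n + 1) → R}
    (h : Polynomial.X ^ m ∣ lineRestriction F x y) {l : R} (hl : IsUnit l) (p q : R) :
    Polynomial.X ^ m ∣ lineRestriction F (fun i => l * x i) fun i => p * y i + q * x i := by
  -- The new vectors satisfy `l x + t (p y + q x) = c (x + T y)` with `c = l + t q` a unit and `T =
  -- t p / c` divisible by `t`. By homogeneity the new restriction is `cᵈ` times the old one at `T`.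
  let c : PowerSeries R := PowerSeries.C l + PowerSeries.X * PowerSeries.C q
  have hc : IsUnit c := by
    rw [PowerSeries.isUnit_iff_constantCoeff]
    simpa [c] using hl
  obtain ⟨c', hc'⟩ := hc.exists_right_inv
  let T : PowerSeries R := PowerSeries.X * (PowerSeries.C p * c')
  have hcoe (P : Polynomial R) :
      Polynomial.aeval (PowerSeries.X : PowerSeries R) P = (P : PowerSeries R) := by
    have : Polynomial.aeval (R := R) (PowerSeries.X : PowerSeries R) =
        Polynomial.coeToPowerSeries.algHom R := by
      ext1
      simp [Polynomial.coeToPowerSeries.algHom_apply]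
    rw [this]
    simp [Polynomial.coeToPowerSeries.algHom_apply]
  have key : ((lineRestriction F (fun i => l * x i) fun i => p * y i + q * x i :
      Polynomial R) : PowerSeries R) = c ^ d * Polynomial.aeval T (lineRestriction F x y) := by
    rw [← hcoe, aeval_lineRestriction, aeval_lineRestriction, ← aeval_smul_of_isHomogeneous hF]
    congr 2
    funext i
    simp only [PowerSeries.algebraMap_apply, Algebra.algebraMap_self, RingHom.id_apply, map_add,
      map_mul, c, T]
    linear_combination (-PowerSeries.X * PowerSeries.C p * PowerSeries.C (y i)) * hc'
  have hdvd : PowerSeries.X ^ m ∣ ((lineRestriction F (fun i => l * x i)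
      fun i => p * y i + q * x i : Polynomial R) : PowerSeries R) := by
    rw [key]
    obtain ⟨P, hP⟩ := h
    rw [hP, map_mul, map_pow, Polynomial.aeval_X, mul_pow]
    exact Dvd.dvd.mul_left (Dvd.dvd.mul_right (Dvd.intro _ rfl) _) _
  rw [PowerSeries.X_pow_dvd_iff] at hdvd
  rw [Polynomial.X_pow_dvd_iff]
  intro i hi
  rw [← Polynomial.coeff_coe]
  exact hdvd i hi

end LineRestriction

/-! ### Charts of the scheme of pairs (point, line) with contact of order three -/

section ContactChart

variable {K : Type u} [Field K] {n d : ℕ} (F : MvPolynomial (Fin (n + 1)) K)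

theorem map_restrictToLine {R : Type*} [CommRing R] [Algebra K R] (f : PairRing K n →ₐ[K] R) :
    (restrictToLine F).map (f : PairRing K n →+* R) =
      lineRestriction F (fun b => f (uVar K n b)) fun b => f (vVar K n b) :=
  map_lineRestriction F f (uVar K n) (vVar K n)

theorem apply_coeff_restrictToLine {R : Type*} [CommRing R] [Algebra K R]
    (f : PairRing K n →ₐ[K] R) (m : ℕ) :
    f ((restrictToLine F).coeff m) =
      (lineRestriction F (fun b => f (uVar K n b)) fun b => f (vVar K n b)).coeff m := by
  rw [← map_restrictToLine, Polynomial.coeff_map]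
  rfl

/-- The equations of the chart `u_i (u_j v_k - u_k v_j) ≠ 0` of the scheme `Y_{F,3}` in the
coordinates normalized by `u_i = 1`, `v_i = 0` and `u_j v_k - u_k v_j = 1`. -/
def contactChartEquations (a : Fin (n + 1) × Fin (n + 1) × Fin (n + 1)) :
    Fin 3 ⊕ Fin 3 → PairRing K n :=
  Sum.elim (fun m => (restrictToLine F).coeff m)
    ![uVar K n a.1 - 1, vVar K n a.1,
      uVar K n a.2.1 * vVar K n a.2.2 - uVar K n a.2.2 * vVar K n a.2.1 - 1]

theorem segrePlucker_X (a : Fin (n + 1) × Fin (n + 1) × Fin (n + 1)) :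
    segrePlucker K n (X a) =
      uVar K n a.1 * (uVar K n a.2.1 * vVar K n a.2.2 - uVar K n a.2.2 * vVar K n a.2.1) :=
  aeval_X _ _

/-- The Segre-Plücker coordinates recover the vectors on the slice: with `a = (i, j, k)`, `z_{bjk}`
restricts to `u_b` and `z_{iib}` restricts to `v_b`. -/
theorem exists_segrePlucker_sub_mem (a : Fin (n + 1) × Fin (n + 1) × Fin (n + 1))
    (b : PairRing K n) :
    ∃ p, segrePlucker K n p - b ∈ Ideal.span (Set.range (contactChartEquations F a)) := by
  have hu : uVar K n a.1 - 1 ∈ Ideal.span (Set.range (contactChartEquations F a)) :=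
    Ideal.subset_span ⟨.inr 0, rfl⟩
  have hv : vVar K n a.1 ∈ Ideal.span (Set.range (contactChartEquations F a)) :=
    Ideal.subset_span ⟨.inr 1, rfl⟩
  have hp : uVar K n a.2.1 * vVar K n a.2.2 - uVar K n a.2.2 * vVar K n a.2.1 - 1 ∈
      Ideal.span (Set.range (contactChartEquations F a)) :=
    Ideal.subset_span ⟨.inr 2, rfl⟩
  induction b using MvPolynomial.induction_on with
  | C c =>
    refine ⟨C c, ?_⟩
    rw [show segrePlucker K n (C c) = C c from (segrePlucker K n).commutes c, sub_self]
    exact zero_mem _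
  | add p q hp hq =>
    obtain ⟨p', hp'⟩ := hp
    obtain ⟨q', hq'⟩ := hq
    refine ⟨p' + q', ?_⟩
    rw [map_add, add_sub_add_comm]
    exact add_mem hp' hq'
  | mul_X p b hp' =>
    obtain ⟨p', hp'⟩ := hp'
    have hX : ∃ q, segrePlucker K n q - X b ∈
        Ideal.span (Set.range (contactChartEquations F a)) := by
      rcases b with b | b
      · refine ⟨X (b, a.2), ?_⟩
        rw [segrePlucker_X]
        have := Ideal.mul_mem_left _ (uVar K n b) hp
        rw [mul_sub, mul_one] at this
        exact this
      · refine ⟨X (a.1, a.1, b), ?_⟩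
        rw [segrePlucker_X]
        have := add_mem (Ideal.mul_mem_left _ ((uVar K n a.1 + 1) * vVar K n b) hu)
          (Ideal.mul_mem_left _ (-uVar K n a.1 * uVar K n b) hv)
        convert this using 1
        rw [show (X (Sum.inr b) : PairRing K n) = vVar K n b from rfl]
        ring
    obtain ⟨q, hq⟩ := hX
    refine ⟨p' * q, ?_⟩
    have := add_mem (Ideal.mul_mem_right (segrePlucker K n q) _ hp') (Ideal.mul_mem_left _ p hq)
    convert this using 1
    rw [map_mul]
    ring

/-- Modulo the contact ideal the generic line has contact of order `m`, and
`X_pow_dvd_lineRestriction` transports this to the changed vectors. -/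
theorem coeff_restrictToLine_normalize_mem (hF : F.IsHomogeneous d) {L : Type u} [CommRing L]
    [Algebra K L] (φ ψ : PairRing K n →ₐ[K] L) {l : L} (hl : IsUnit l) (p q : L)
    (hu : ∀ b, ψ (uVar K n b) = l * φ (uVar K n b))
    (hv : ∀ b, ψ (vVar K n b) = p * φ (vVar K n b) + q * φ (uVar K n b)) (m : ℕ) :
    ∀ i < m, ψ ((restrictToLine F).coeff i) ∈ (contactIdeal F m).map φ := by
  set J := (contactIdeal F m).map φ
  let π : L →ₐ[K] L ⧸ J := Ideal.Quotient.mkₐ K J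
  have h1 : Polynomial.X ^ m ∣ lineRestriction F (fun b => (π.comp φ) (uVar K n b))
      fun b => (π.comp φ) (vVar K n b) := by
    rw [Polynomial.X_pow_dvd_iff]
    intro i hi
    rw [← apply_coeff_restrictToLine]
    exact Ideal.Quotient.eq_zero_iff_mem.mpr
      (Ideal.mem_map_of_mem _ (Ideal.subset_span ⟨i, hi, rfl⟩))
  have h2 := X_pow_dvd_lineRestriction F hF h1 (hl.map π) (π p) (π q)
  rw [Polynomial.X_pow_dvd_iff] at h2
  intro i hi
  have h3 := h2 i hi
  refine Ideal.Quotient.eq_zero_iff_mem.mp ?_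
  change (π.comp ψ) _ = 0
  rw [apply_coeff_restrictToLine, ← h3]
  simp only [AlgHom.comp_apply, hu, hv, map_mul, map_add]

theorem contact_chartIsSmooth_iff (hF : F.IsHomogeneous d)
    (a : Fin (n + 1) × Fin (n + 1) × Fin (n + 1)) (e : ℕ) :
    @ChartIsSmooth _ _ _ (contactSchemeIdeal F 3)
        (quotGradedAlgebra _ (contactSchemeIdeal_isHomogeneous F hF 3)) e a ↔
      RingHom.Locally (RingHom.IsStandardSmoothOfRelativeDimension e)
        (algebraMap K (PairRing K n ⧸ Ideal.span (Set.range (contactChartEquations F a)))) := by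
  let := quotGradedAlgebra _ (contactSchemeIdeal_isHomogeneous F hF 3)
  let L := Localization.Away (segrePlucker K n (X a))
  let φ : PairRing K n →ₐ[K] L := IsScalarTower.toAlgHom K _ L
  let w : L := IsLocalization.Away.invSelf (segrePlucker K n (X a))
  let U := φ (uVar K n a.1)
  let V := φ (vVar K n a.1)
  let P := φ (uVar K n a.2.1 * vVar K n a.2.2 - uVar K n a.2.2 * vVar K n a.2.1)
  have hφX (b) : φ (segrePlucker K n (X b)) = φ (uVar K n b.1) *
      φ (uVar K n b.2.1 * vVar K n b.2.2 - uVar K n b.2.2 * vVar K n b.2.1) :=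
    (congrArg φ (segrePlucker_X b)).trans (map_mul φ _ _)
  have hw : U * P * w = 1 :=
    (congrArg (· * w) (hφX a)).symm.trans
      (IsLocalization.Away.mul_invSelf (segrePlucker K n (X a)))
  -- As `w = 1 / (U P)`, this is `u ↦ u / U`, `v ↦ (U v - V u) / P`. It keeps the flag and achieves
  -- the three normalizations; all Plücker coordinates are divided by `P`.
  let ψ : PairRing K n →ₐ[K] L := aeval (Sum.elim (fun b => P * w * φ (uVar K n b))
    fun b => U * U * w * φ (vVar K n b) + -V * U * w * φ (uVar K n b))
  have hψu (b) : ψ (uVar K n b) = P * w * φ (uVar K n b) := aeval_X _ _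
  have hψv (b) : ψ (vVar K n b) = U * U * w * φ (vVar K n b) + -V * U * w * φ (uVar K n b) :=
    aeval_X _ _
  have hψp (b c) : ψ (uVar K n b * vVar K n c - uVar K n c * vVar K n b) =
      U * w * φ (uVar K n b * vVar K n c - uVar K n c * vVar K n b) := by
    simp only [map_sub, map_mul, hψu, hψv]
    linear_combination (U * w * (φ (uVar K n b) * φ (vVar K n c) -
      φ (uVar K n c) * φ (vVar K n b))) * hw
  have hPw : IsUnit (P * w) := IsUnit.of_mul_eq_one U (by rw [← hw]; ring)
  refine chartIsSmooth_iff (contactSchemeIdeal F 3) (segrePlucker K n) (contactIdeal F 3) _ rfl a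
    ?_ ?_ (exists_segrePlucker_sub_mem F a) ψ ?_ ?_ e
  · rw [contactIdeal, Ideal.span_le]
    rintro _ ⟨k, hk, rfl⟩
    exact Ideal.subset_span ⟨.inl ⟨k, hk⟩, rfl⟩
  · rw [segrePlucker_X]
    have := add_mem (Ideal.subset_span ⟨.inr 0, rfl⟩ : uVar K n a.1 - 1 ∈
        Ideal.span (Set.range (contactChartEquations F a)))
      (Ideal.mul_mem_left _ (uVar K n a.1) (Ideal.subset_span ⟨.inr 2, rfl⟩ :
        uVar K n a.2.1 * vVar K n a.2.2 - uVar K n a.2.2 * vVar K n a.2.1 - 1 ∈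
          Ideal.span (Set.range (contactChartEquations F a))))
    convert this using 1
    ring
  · intro b
    change φ _ * ψ _ = φ _
    have hψX : ψ (segrePlucker K n (X b)) = _ :=
      (congrArg ψ (segrePlucker_X b)).trans (map_mul ψ _ _)
    rw [hφX, hφX, hψX, hψp, hψu]
    change U * P * _ = _
    linear_combination (φ (uVar K n b.1) *
      φ (uVar K n b.2.1 * vVar K n b.2.2 - uVar K n b.2.2 * vVar K n b.2.1)) *
        (U * P * w + 1) * hw
  · suffices h : Ideal.span (Set.range (contactChartEquations F a)) ≤
        ((contactIdeal F 3).map φ).comap ψ from fun b hb => h hb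
    rw [Ideal.span_le]
    rintro _ ⟨j | j, rfl⟩
    · exact coeff_restrictToLine_normalize_mem F hF φ ψ hPw _ _ hψu hψv 3 j j.2
    · change ψ _ ∈ (contactIdeal F 3).map φ
      suffices h : ψ (contactChartEquations F a (Sum.inr j)) = 0 by
        rw [h]
        exact zero_mem _
      fin_cases j
      · change ψ (uVar K n a.1 - 1) = 0
        rw [map_sub, map_one, hψu]
        linear_combination hw
      · change ψ (vVar K n a.1) = 0
        rw [hψv]
        change U * U * w * V + -V * U * w * U = 0
        ring
      · change ψ (_ - 1) = 0
        rw [map_sub, map_one, hψp]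
        linear_combination hw

end ContactChart

/-! ### Coefficients of the restriction to a line and their derivatives -/

section

variable {K Ω : Type u} [Field K] [Field Ω] [Algebra K Ω] {n d : ℕ}
  (F : MvPolynomial (Fin (n + 1)) K)

theorem lineRestriction_smul {R : Type*} [CommRing R] [Algebra K R] (x y : Fin (n + 1) → R)
    (c : R) (m : ℕ) :
    (lineRestriction F x fun i => c * y i).coeff m = c ^ m * (lineRestriction F x y).coeff m := by
  have h : lineRestriction F x (fun i => c * y i) =
      (lineRestriction F x y).comp (Polynomial.C c * Polynomial.X) := by
    rw [show (lineRestriction F x y).comp (Polynomial.C c * Polynomial.X) =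
      Polynomial.aeval (Polynomial.C c * Polynomial.X) (lineRestriction F x y) from rfl,
      aeval_lineRestriction, lineRestriction]
    congr 2
    funext i
    simp only [Polynomial.algebraMap_eq, map_mul]
    ring
  rw [h, Polynomial.comp_C_mul_X_coeff, mul_comm]

/-- The homogenization of `F(x + t y)` for a quadratic form `F`. -/
theorem aeval_mul_add_of_isHomogeneous_two [Infinite Ω] (hF : F.IsHomogeneous 2)
    (x y : Fin (n + 1) → Ω) (s : Ω) :
    aeval (fun i => s * x i + y i) F = (lineRestriction F x y).coeff 0 * s ^ 2 +
      (lineRestriction F x y).coeff 1 * s + (lineRestriction F x y).coeff 2 := by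
  set P := lineRestriction F x y with hP
  have hdeg : P.natDegree ≤ 2 := by
    rw [hP, lineRestriction, ← aeval_map_algebraMap Ω]
    refine aeval_natDegree_le (m := 2) (n := 1) _
      (hF.map _).totalDegree_le _ fun i => ?_
    compute_degree
  have h : aeval (fun i => Polynomial.X * Polynomial.C (x i) + Polynomial.C (y i)) F =
      Polynomial.C (P.coeff 0) * Polynomial.X ^ 2 + Polynomial.C (P.coeff 1) * Polynomial.X +
        Polynomial.C (P.coeff 2) := by
    -- The extra factor `X` makes the comparison trivial at `r = 0`; elsewhere `r x + y = r (x + r⁻¹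
    -- y)`.
    refine mul_left_cancel₀ Polynomial.X_ne_zero (Polynomial.funext fun r => ?_)
    rcases eq_or_ne r 0 with rfl | hr
    · simp
    have h1 : (aeval (fun i => Polynomial.X * Polynomial.C (x i) + Polynomial.C (y i)) F).eval r =
        aeval (fun i => r * (x i + r⁻¹ * y i)) F := by
      have : ((Polynomial.aeval r).restrictScalars K).comp
          (aeval fun i => Polynomial.X * Polynomial.C (x i) + Polynomial.C (y i)) =
          aeval fun i => r * (x i + r⁻¹ * y i) := algHom_ext fun i => by
        simp only [AlgHom.comp_apply, aeval_X, AlgHom.restrictScalars_apply, map_add, map_mul,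
          Polynomial.aeval_X, Polynomial.aeval_C, Algebra.algebraMap_self, RingHom.id_apply, mul_add,
          mul_inv_cancel_left₀ hr]
      exact DFunLike.congr_fun this F
    have h2 : aeval (fun i => x i + r⁻¹ * y i) F =
        P.coeff 0 + P.coeff 1 * r⁻¹ + P.coeff 2 * r⁻¹ ^ 2 := by
      have := aeval_lineRestriction F r⁻¹ x y
      rw [← hP, Polynomial.aeval_def, Polynomial.eval₂_eq_sum_range' _ (Nat.lt_succ_of_le hdeg)]
        at this
      simpa [Finset.sum_range_succ] using this.symm
    rw [Polynomial.eval_mul, h1, aeval_smul_of_isHomogeneous hF, h2]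
    simp only [Polynomial.eval_mul, Polynomial.eval_X, Polynomial.eval_add, Polynomial.eval_C,
      Polynomial.eval_pow]
    field_simp
  have h1 := congrArg (Polynomial.eval s) h
  have h2 : (aeval (fun i => Polynomial.X * Polynomial.C (x i) + Polynomial.C (y i)) F).eval s =
      aeval (fun i => s * x i + y i) F := by
    have : ((Polynomial.aeval s).restrictScalars K).comp
        (aeval fun i => Polynomial.X * Polynomial.C (x i) + Polynomial.C (y i)) =
        aeval fun i => s * x i + y i := algHom_ext fun i => by simp [mul_comm s]
    exact DFunLike.congr_fun this F
  rw [h2] at h1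
  simpa using h1

theorem lineRestriction_coeff_one (x y : Fin (n + 1) → Ω) :
    (lineRestriction F x y).coeff 1 = ∑ i, aeval x (pderiv i F) * y i := by
  have h1 : Polynomial.aeval (DualNumber.eps : DualNumber Ω) (lineRestriction F x y) =
      tangentHom K x y F := by
    rw [aeval_lineRestriction, tangentHom]
    congr 2
    funext i
    ext <;> simp [TrivSqZeroExt.algebraMap_eq_inl]
  have h2 (P : Polynomial Ω) : (Polynomial.aeval (DualNumber.eps : DualNumber Ω) P).snd =
      P.coeff 1 := by
    conv_lhs => rw [← Polynomial.divX_mul_X_add P]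
    have h3 : (Polynomial.aeval (DualNumber.eps : DualNumber Ω) P.divX).fst = P.divX.coeff 0 := by
      have : (TrivSqZeroExt.fstHom Ω Ω Ω).comp (Polynomial.aeval DualNumber.eps) =
          Polynomial.aeval (0 : Ω) := by
        ext
        simp
      rw [Polynomial.coeff_zero_eq_aeval_zero, ← this]
      rfl
    rw [map_add, map_mul, Polynomial.aeval_X, Polynomial.aeval_C, TrivSqZeroExt.snd_add,
      TrivSqZeroExt.algebraMap_eq_inl]
    simp [h3, Polynomial.coeff_divX]
  rw [← snd_tangentHom, ← h1, h2]

theorem coeff_lineRestriction_inl (x y : Fin (n + 1) → Ω) (m : ℕ) :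
    (lineRestriction F (fun b => (TrivSqZeroExt.inl (x b) : DualNumber Ω))
      fun b => TrivSqZeroExt.inl (y b)).coeff m =
      TrivSqZeroExt.inl ((lineRestriction F x y).coeff m) := by
  have h := map_lineRestriction F ((TrivSqZeroExt.inlAlgHom Ω Ω Ω).restrictScalars K) x y
  have h2 := congrArg (Polynomial.coeff · m) h
  rw [Polynomial.coeff_map] at h2
  exact h2.symm

/-- The derivatives of the coefficients of `F(u + t v)`. -/
theorem snd_tangentHom_coeff_restrictToLine (z a : Fin (n + 1) ⊕ Fin (n + 1) → Ω) (m : ℕ) :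
    (tangentHom K z a ((restrictToLine F).coeff m)).snd =
      (∑ i, lineRestriction (pderiv i F) (fun b => z (.inl b)) (fun b => z (.inr b)) *
        (Polynomial.C (a (.inl i)) + Polynomial.X * Polynomial.C (a (.inr i)))).coeff m := by
  rw [apply_coeff_restrictToLine]
  let w : Fin (n + 1) → Polynomial (DualNumber Ω) := fun b =>
    Polynomial.C (TrivSqZeroExt.inl (z (.inl b))) +
      Polynomial.X * Polynomial.C (TrivSqZeroExt.inl (z (.inr b)))
  let c : Fin (n + 1) → Polynomial (DualNumber Ω) := fun b =>
    Polynomial.C (TrivSqZeroExt.inl (a (.inl b))) +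
      Polynomial.X * Polynomial.C (TrivSqZeroExt.inl (a (.inr b)))
  have he : (Polynomial.C DualNumber.eps * Polynomial.C DualNumber.eps :
      Polynomial (DualNumber Ω)) = 0 := by
    rw [← Polynomial.C_mul, DualNumber.eps_mul_eps, Polynomial.C_0]
  have h1 : (lineRestriction F (fun b => tangentHom K z a (uVar K n b))
      fun b => tangentHom K z a (vVar K n b)) =
      aeval w F + Polynomial.C DualNumber.eps * ∑ b, aeval w (pderiv b F) * c b := by
    rw [← aeval_add_mul_of_sq_eq_zero w c he F, lineRestriction]
    congr 2
    funext b
    have h2 (r : Ω) : (TrivSqZeroExt.inr r : DualNumber Ω) =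
        DualNumber.eps * TrivSqZeroExt.inl r := by
      ext <;> simp
    simp only [tangentHom, uVar, vVar, aeval_X, h2, map_add, map_mul, w, c]
    ring
  set Q := ∑ i, lineRestriction (pderiv i F) (fun b => z (.inl b)) (fun b => z (.inr b)) *
    (Polynomial.C (a (.inl i)) + Polynomial.X * Polynomial.C (a (.inr i))) with hQ
  have h3 : ∑ b, aeval w (pderiv b F) * c b = Q.map (TrivSqZeroExt.inlHom Ω Ω) := by
    rw [hQ, Polynomial.map_sum]
    refine Finset.sum_congr rfl fun b _ => ?_
    rw [Polynomial.map_mul]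
    refine congrArg₂ (· * ·) (map_lineRestriction (pderiv b F)
      ((TrivSqZeroExt.inlAlgHom Ω Ω Ω).restrictScalars K) _ _).symm ?_
    simp [c]
  have h4 : (aeval w F).coeff m = TrivSqZeroExt.inl
      ((lineRestriction F (fun b => z (.inl b)) fun b => z (.inr b)).coeff m) :=
    coeff_lineRestriction_inl F _ _ m
  rw [h1, h3, Polynomial.coeff_add, h4, Polynomial.coeff_C_mul, Polynomial.coeff_map]
  simp

/-- The coefficients of order less than `m` of `F(u + t v)` are stationary in the directions that
only change the vectors representing the flag. -/
theorem snd_tangentHom_coeff_restrictToLine_of_orbit (hF : F.IsHomogeneous d) {m : ℕ}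
    {z : Fin (n + 1) ⊕ Fin (n + 1) → Ω}
    (hz : ∀ k < m, aeval z ((restrictToLine F).coeff k) = 0) (α β γ : Ω) :
    ∀ k < m, (tangentHom K z (Sum.elim (fun b => α * z (.inl b))
      fun b => β * z (.inl b) + γ * z (.inr b)) ((restrictToLine F).coeff k)).snd = 0 := by
  have h1 : Polynomial.X ^ m ∣ lineRestriction F
      (fun b => (TrivSqZeroExt.inl (z (.inl b)) : DualNumber Ω))
      fun b => TrivSqZeroExt.inl (z (.inr b)) := by
    rw [Polynomial.X_pow_dvd_iff]
    intro k hk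
    have h2 := hz k hk
    rw [apply_coeff_restrictToLine] at h2
    simp only [uVar, vVar, aeval_X] at h2
    rw [coeff_lineRestriction_inl, h2, TrivSqZeroExt.inl_zero]
  -- Independence of the representing vectors, applied over the dual numbers to the infinitesimal
  -- change `u ↦ (1 + εα) u`, `v ↦ (1 + εγ) v + εβ u`.
  have h2 := X_pow_dvd_lineRestriction F hF h1 (l := 1 + TrivSqZeroExt.inr α)
    (by rw [TrivSqZeroExt.isUnit_iff_isUnit_fst]; simp) (1 + TrivSqZeroExt.inr γ)
    (TrivSqZeroExt.inr β)
  rw [Polynomial.X_pow_dvd_iff] at h2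
  intro k hk
  have h3 := h2 k hk
  rw [apply_coeff_restrictToLine]
  have h4 (b) : tangentHom K z (Sum.elim (fun b => α * z (.inl b))
      fun b => β * z (.inl b) + γ * z (.inr b)) (uVar K n b) =
      (1 + TrivSqZeroExt.inr α) * TrivSqZeroExt.inl (z (.inl b)) := by
    rw [uVar, tangentHom, aeval_X]
    ext <;> simp [mul_comm]
  have h5 (b) : tangentHom K z (Sum.elim (fun b => α * z (.inl b))
      fun b => β * z (.inl b) + γ * z (.inr b)) (vVar K n b) =
      (1 + TrivSqZeroExt.inr γ) * TrivSqZeroExt.inl (z (.inr b)) +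
        TrivSqZeroExt.inr β * TrivSqZeroExt.inl (z (.inl b)) := by
    rw [vVar, tangentHom, aeval_X]
    ext <;> simp [mul_comm, add_comm]
  simp only [h4, h5, h3, TrivSqZeroExt.snd_zero]

end

/-! ### Singular points of the hypersurface and tangent spaces of the contact scheme -/

section

variable {K Ω : Type u} [Field K] [Field Ω] [Algebra K Ω] {n d : ℕ}
  (F : MvPolynomial (Fin (n + 1)) K)

theorem aeval_coeff_restrictToLine (z : Fin (n + 1) ⊕ Fin (n + 1) → Ω) (m : ℕ) :
    aeval z ((restrictToLine F).coeff m) =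
      (lineRestriction F (fun b => z (.inl b)) fun b => z (.inr b)).coeff m := by
  rw [apply_coeff_restrictToLine]
  simp only [uVar, vVar, aeval_X]

variable [IsAlgClosed Ω]

/-- A form in two variables of positive degree over an algebraically closed field has a zero;
here the form is `f_m(x, s y + r y')`. -/
theorem exists_coeff_lineRestriction_eq_zero {m : ℕ} (hm : 0 < m) (x : Fin (n + 1) → Ω)
    {j k : Fin (n + 1)} (hjk : j ≠ k) :
    ∃ y : Fin (n + 1) → Ω, (∀ i, i ≠ j → i ≠ k → y i = 0) ∧ y ≠ 0 ∧
      (lineRestriction F x y).coeff m = 0 := by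
  by_contra! hcon
  let e (j : Fin (n + 1)) : Fin (n + 1) → Ω := Pi.single j 1
  have he (j : Fin (n + 1)) : e j j = 1 := Pi.single_eq_same j 1
  have he' {i j : Fin (n + 1)} (h : i ≠ j) : e j i = 0 := Pi.single_eq_of_ne h 1
  -- Without zeros, the polynomial `s ↦ f_m(x, s e_j + e_k)` has no root and is therefore constant.
  have key (j k : Fin (n + 1)) (hjk : j ≠ k)
      (hcon : ∀ y : Fin (n + 1) → Ω, (∀ i, i ≠ j → i ≠ k → y i = 0) → y ≠ 0 →
        (lineRestriction F x y).coeff m ≠ 0) :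
      ∀ s : Ω, (lineRestriction F x (s • e j + e k)).coeff m =
        (lineRestriction F x (e k)).coeff m := by
    let P : Polynomial Ω := (lineRestriction F (fun b => Polynomial.C (x b)) fun b =>
      Polynomial.X * Polynomial.C (e j b) + Polynomial.C (e k b)).coeff m
    have hP (s : Ω) : P.eval s =
        (lineRestriction F x (s • e j + e k)).coeff m := by
      have h := map_lineRestriction F ((Polynomial.aeval s).restrictScalars K)
        (fun b => Polynomial.C (x b)) fun b =>
          Polynomial.X * Polynomial.C (e j b) + Polynomial.C (e k b)
      have h2 := congrArg (Polynomial.coeff · m) h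
      rw [Polynomial.coeff_map] at h2
      have hx : ((Polynomial.aeval s).restrictScalars K : Polynomial Ω →ₐ[K] Ω) ∘
          (fun b => Polynomial.C (x b)) = x := by
        funext b
        simp
      have hy : ((Polynomial.aeval s).restrictScalars K : Polynomial Ω →ₐ[K] Ω) ∘
          (fun b => Polynomial.X * Polynomial.C (e j b) +
            Polynomial.C (e k b)) = s • e j + e k := by
        funext b
        simp [mul_comm s]
      rw [hx, hy] at h2
      exact h2
    have hdeg : P.degree = 0 := by
      by_contra hdeg
      obtain ⟨s, hs⟩ := IsAlgClosed.exists_root P hdeg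
      rw [Polynomial.IsRoot, hP] at hs
      refine hcon _ (fun i hij hik => ?_) (fun h0 => ?_) hs
      · simp [he' hij, he' hik]
      · have := congrFun h0 k
        simp [he, he' hjk.symm] at this
    intro s
    have h0 := hP 0
    rw [zero_smul, zero_add] at h0
    rw [← hP, ← h0, Polynomial.eq_C_of_degree_eq_zero hdeg, Polynomial.eval_C, Polynomial.eval_C]
  have h1 := key j k hjk hcon
  have h2 := key k j hjk.symm fun y hy => hcon y fun i hi hi' => hy i hi' hi
  set A := (lineRestriction F x (e k)).coeff m
  set B := (lineRestriction F x (e j)).coeff m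
  -- Constancy in both affine charts of the pencil, compared by `s e_j + e_k = s (e_j + s⁻¹ e_k)`.
  -- It forces `s ^ m = 1` for all nonzero `s`, impossible over an infinite field.
  have hAB (s : Ω) (hs : s ≠ 0) : A = s ^ m * B := by
    rw [← h1 s, ← h2 s⁻¹, ← lineRestriction_smul]
    congr 2
    funext i
    simp only [Pi.add_apply, Pi.smul_apply, smul_eq_mul, mul_add, mul_inv_cancel_left₀ hs]
    ring
  have hB : B ≠ 0 := hcon _ (fun i hij _ => he' hij) fun h0 => by
    exact one_ne_zero ((he j).symm.trans (congrFun h0 j))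
  have hpow (s : Ω) (hs : s ≠ 0) : s ^ m = 1 := by
    have h3 := hAB 1 one_ne_zero
    rw [hAB s hs, one_pow] at h3
    exact mul_right_cancel₀ hB h3
  have hpoly : (Polynomial.X ^ m - 1 : Polynomial Ω) * Polynomial.X = 0 := by
    refine Polynomial.funext fun s => ?_
    rcases eq_or_ne s 0 with rfl | hs
    · simp
    · simp [hpow s hs]
  rw [mul_eq_zero, or_iff_left Polynomial.X_ne_zero, ← Polynomial.C_1] at hpoly
  exact Polynomial.X_pow_sub_C_ne_zero hm 1 hpoly

theorem isNonsingular_of_contact_smooth (hn : 2 ≤ n) (hF : F.IsHomogeneous 3)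
    (h : ∀ a : Fin (n + 1) × Fin (n + 1) × Fin (n + 1),
      RingHom.Locally (RingHom.IsStandardSmoothOfRelativeDimension (2 * n - 4))
        (algebraMap K (PairRing K n ⧸ Ideal.span (Set.range (contactChartEquations F a))))) :
    IsNonsingular F Ω := by
  classical
  intro x hx hdx
  by_contra hx0
  obtain ⟨i, hi⟩ := Function.ne_iff.mp hx0
  let u : Fin (n + 1) → Ω := fun b => (x i)⁻¹ * x b
  have hui : u i = 1 := inv_mul_cancel₀ hi
  have hu : aeval u F = 0 := by rw [aeval_smul_of_isHomogeneous hF, hx, mul_zero]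
  have hdu (b) : aeval u (pderiv b F) = 0 := by
    rw [aeval_smul_of_isHomogeneous (hF.pderiv (i := b)), hdx, mul_zero]
  obtain ⟨j, k, hij, hik, hjk⟩ : ∃ j k : Fin (n + 1), i ≠ j ∧ i ≠ k ∧ j ≠ k := by
    have : 1 < (Finset.univ.erase i).card := by
      rw [Finset.card_erase_of_mem (Finset.mem_univ i), Finset.card_univ, Fintype.card_fin]
      omega
    obtain ⟨j, hj, k, hk, hjk⟩ := Finset.one_lt_card.mp this
    exact ⟨j, k, (Finset.ne_of_mem_erase hj).symm, (Finset.ne_of_mem_erase hk).symm, hjk⟩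
  -- Taking the direction in the span of `e_j` and `e_k` gives `y i = 0`, so it is independent of
  -- `u` and already satisfies the normalization `v_i = 0`.
  obtain ⟨y, hy, hy0, hf2⟩ := exists_coeff_lineRestriction_eq_zero F two_pos u hjk
  obtain ⟨l, hl⟩ := Function.ne_iff.mp hy0
  let v : Fin (n + 1) → Ω := fun b => (y l)⁻¹ * y b
  have hvi : v i = 0 := by simp [v, hy i hij hik]
  have hvl : v l = 1 := inv_mul_cancel₀ hl
  have hv2 : (lineRestriction F u v).coeff 2 = 0 := by
    rw [lineRestriction_smul, hf2, mul_zero]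
  have hv1 : (lineRestriction F u v).coeff 1 = 0 := by
    rw [lineRestriction_coeff_one]
    simp [hdu]
  have hv0 : (lineRestriction F u v).coeff 0 = 0 := by rw [lineRestriction_coeff_zero, hu]
  let z : Fin (n + 1) ⊕ Fin (n + 1) → Ω := Sum.elim u v
  let g := contactChartEquations F (i, i, l)
  have hz : ∀ m, aeval z (g m) = 0 := by
    rintro (m | m)
    · change aeval z ((restrictToLine F).coeff m) = 0
      rw [aeval_coeff_restrictToLine]
      change (lineRestriction F u v).coeff m = 0
      fin_cases m
      exacts [hv0, hv1, hv2]
    · fin_cases m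
      · change aeval z (uVar K n i - 1) = 0
        simp [uVar, z, hui]
      · change aeval z (vVar K n i) = 0
        simp [vVar, z, hvi]
      · change aeval z (uVar K n i * vVar K n l - uVar K n l * vVar K n i - 1) = 0
        simp [uVar, vVar, z, hvi, hui, hvl]
  -- The differential of `f₀` vanishes at `z`, so five differentials cut out the tangent space,
  -- leaving dimension at least `(2n + 2) - 5 = 2n - 3`.
  let D : (Fin (n + 1) ⊕ Fin (n + 1) → Ω) →ₗ[Ω] ({m : Fin 3 ⊕ Fin 3 // m ≠ .inl 0} → Ω) :=
    Matrix.toLin' (Matrix.of fun m b => aeval z (pderiv b (g m)))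
  have h1 := finrank_tangent_le_of_locally g (h (i, i, l)) z hz (LinearMap.ker D) (by
    intro a ha m
    by_cases hm : m = .inl 0
    · rw [hm, ← snd_tangentHom]
      change (tangentHom K z a ((restrictToLine F).coeff 0)).snd = 0
      rw [snd_tangentHom_coeff_restrictToLine, Polynomial.finsetSum_coeff]
      refine Finset.sum_eq_zero fun b _ => ?_
      rw [Polynomial.mul_coeff_zero, lineRestriction_coeff_zero]
      change aeval u (pderiv b F) * _ = 0
      rw [hdu, zero_mul]
    · exact congrFun ha ⟨m, hm⟩)
  have h2 := card_sub_card_le_finrank_ker D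
  have h3 : Fintype.card {m : Fin 3 ⊕ Fin 3 // m ≠ .inl 0} = 5 := rfl
  rw [h3, Fintype.card_sum, Fintype.card_fin] at h2
  omega

/-- Write `F_b(u + t v) = q₀ + q₁ t + q₂ t²`. If `c₂ ≠ 0`, the two relations express `q₁` and `q₂`
as multiples of `q₀` by factors independent of `b`. So the `F_b` restricted to the line are
proportional to one quadratic form, and they share a zero. -/
theorem coeffs_eq_zero_of_isNonsingular (h3 : (3 : Ω) ≠ 0) (hF : F.IsHomogeneous 3)
    (hns : IsNonsingular F Ω) {u v : Fin (n + 1) → Ω} {i j k : Fin (n + 1)} (hu : u i = 1)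
    (hp : u j * v k - u k * v j = 1) (hFu : aeval u F = 0) {c₀ c₁ c₂ : Ω}
    (ha : ∀ b, c₀ * (lineRestriction (pderiv b F) u v).coeff 0 +
      c₁ * (lineRestriction (pderiv b F) u v).coeff 1 +
      c₂ * (lineRestriction (pderiv b F) u v).coeff 2 = 0)
    (hb : ∀ b, c₁ * (lineRestriction (pderiv b F) u v).coeff 0 +
      c₂ * (lineRestriction (pderiv b F) u v).coeff 1 = 0) :
    c₀ = 0 ∧ c₁ = 0 ∧ c₂ = 0 := by
  have hc2 : c₂ = 0 := by
    by_contra hc2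
    -- Eliminating `q₁` and `q₂` gives `c₂² F_b(s u + v) = q₀ P(s)` for every `b`, so any root of
    -- `P` serves.
    let P : Polynomial Ω := Polynomial.C (c₂ ^ 2) * Polynomial.X ^ 2 +
      Polynomial.C (-(c₁ * c₂)) * Polynomial.X + Polynomial.C (c₁ ^ 2 - c₀ * c₂)
    obtain ⟨s, hs⟩ := IsAlgClosed.exists_root P (by
      rw [Polynomial.degree_quadratic (pow_ne_zero 2 hc2)]
      decide)
    have hs : c₂ ^ 2 * s ^ 2 - c₁ * c₂ * s + (c₁ ^ 2 - c₀ * c₂) = 0 := by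
      simpa [P, sub_eq_add_neg] using hs
    let w : Fin (n + 1) → Ω := fun b => s * u b + v b
    have hdw (b) : aeval w (pderiv b F) = 0 := by
      have h1 := aeval_mul_add_of_isHomogeneous_two (pderiv b F) (hF.pderiv (i := b)) u v s
      change aeval w (pderiv b F) = _ at h1
      rw [h1]
      refine (mul_eq_zero.mp ?_).resolve_left (pow_ne_zero 2 hc2)
      linear_combination (lineRestriction (pderiv b F) u v).coeff 0 * hs +
        (c₂ * s - c₁) * hb b + c₂ * ha b
    have hFw : aeval w F = 0 := by
      have h1 := congrArg (aeval w) hF.sum_X_mul_pderiv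
      rw [map_sum, map_nsmul] at h1
      simp only [map_mul, hdw, mul_zero, Finset.sum_const_zero, nsmul_eq_mul, Nat.cast_ofNat] at h1
      exact (mul_eq_zero.mp h1.symm).resolve_left h3
    have hw := hns w hFw hdw
    have hwj : s * u j + v j = 0 := congrFun hw j
    have hwk : s * u k + v k = 0 := congrFun hw k
    -- `s u + v = 0` would make `u` and `v` dependent, contradicting the Plücker coordinate equal to
    -- `1`.
    exact one_ne_zero (α := Ω) (by linear_combination -hp + u j * hwk - u k * hwj)
  obtain ⟨b, hb0⟩ : ∃ b, (lineRestriction (pderiv b F) u v).coeff 0 ≠ 0 := by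
    by_contra! hcon
    have := hns u hFu fun b => by rw [← lineRestriction_coeff_zero _ u v, hcon]
    rw [this] at hu
    exact zero_ne_one hu
  have hc1 : c₁ = 0 := by
    have := hb b
    rw [hc2, zero_mul, add_zero] at this
    exact (mul_eq_zero.mp this).resolve_right hb0
  have hc0 : c₀ = 0 := by
    have := ha b
    rw [hc2, hc1, zero_mul, zero_mul, add_zero, add_zero] at this
    exact (mul_eq_zero.mp this).resolve_right hb0
  exact ⟨hc0, hc1, hc2⟩

theorem contact_smooth_of_isNonsingular (h3 : (3 : Ω) ≠ 0) (hF : F.IsHomogeneous 3)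
    (hns : IsNonsingular F Ω) (a : Fin (n + 1) × Fin (n + 1) × Fin (n + 1)) :
    RingHom.Locally (RingHom.IsStandardSmoothOfRelativeDimension (2 * n - 4))
      (algebraMap K (PairRing K n ⧸ Ideal.span (Set.range (contactChartEquations F a)))) := by
  have h := locally_isStandardSmooth_of_linearIndependent (Ω := Ω) (contactChartEquations F a)
    fun z hz => by
      obtain ⟨i, j, k⟩ := a
      have hzf (m : ℕ) (hm : m < 3) : aeval z ((restrictToLine F).coeff m) = 0 :=
        hz (.inl ⟨m, hm⟩)
      have hui : z (.inl i) = 1 := by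
        have : aeval z (uVar K n i - 1) = 0 := hz (.inr 0)
        simpa [uVar, sub_eq_zero] using this
      have hvi : z (.inr i) = 0 := by
        have : aeval z (vVar K n i) = 0 := hz (.inr 1)
        simpa [vVar] using this
      have hp : z (.inl j) * z (.inr k) - z (.inl k) * z (.inr j) = 1 := by
        have : aeval z (uVar K n j * vVar K n k - uVar K n k * vVar K n j - 1) = 0 := hz (.inr 2)
        simpa [uVar, vVar, sub_eq_zero] using this
      refine linearIndependent_of_forall_tangent _ z fun c hc => ?_
      have hc (b : Fin (n + 1) ⊕ Fin (n + 1) → Ω) :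
          (c (.inl 0) * (tangentHom K z b ((restrictToLine F).coeff 0)).snd +
            c (.inl 1) * (tangentHom K z b ((restrictToLine F).coeff 1)).snd +
            c (.inl 2) * (tangentHom K z b ((restrictToLine F).coeff 2)).snd) +
          (c (.inr 0) * b (.inl i) + c (.inr 1) * b (.inr i) +
            c (.inr 2) * (z (.inl j) * b (.inr k) + b (.inl j) * z (.inr k) -
              (z (.inl k) * b (.inr j) + b (.inl k) * z (.inr j)))) = 0 := by
        have h1 := hc b
        rw [Fintype.sum_sum_type, Fin.sum_univ_three, Fin.sum_univ_three] at h1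
        change _ + (c (.inr 0) * (tangentHom K z b (uVar K n i - 1)).snd +
          c (.inr 1) * (tangentHom K z b (vVar K n i)).snd +
          c (.inr 2) * (tangentHom K z b
            (uVar K n j * vVar K n k - uVar K n k * vVar K n j - 1)).snd) = 0 at h1
        have h2 : (tangentHom K z b (uVar K n i - 1)).snd = b (.inl i) := by
          simp [tangentHom, uVar]
        have h4 : (tangentHom K z b (vVar K n i)).snd = b (.inr i) := by
          simp [tangentHom, vVar]
        have h5 : (tangentHom K z b
            (uVar K n j * vVar K n k - uVar K n k * vVar K n j - 1)).snd =
            z (.inl j) * b (.inr k) + b (.inl j) * z (.inr k) -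
              (z (.inl k) * b (.inr j) + b (.inl k) * z (.inr j)) := by
          simp [tangentHom, uVar, vVar, mul_comm]
        rw [h2, h4, h5] at h1
        exact h1
      -- Testing the relation on the three-parameter family of directions that fix the flag removes
      -- the `fₘ` and leaves only the normalizations, whose differentials are independent there.
      have horb (α β γ : Ω) : c (.inr 0) * α + c (.inr 1) * β + c (.inr 2) * (α + γ) = 0 := by
        have h1 := hc (Sum.elim (fun b => α * z (.inl b))
          fun b => β * z (.inl b) + γ * z (.inr b))
        have h2 := snd_tangentHom_coeff_restrictToLine_of_orbit F hF hzf α β γ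
        rw [h2 0 (by norm_num), h2 1 (by norm_num), h2 2 (by norm_num)] at h1
        simp only [Sum.elim_inl, Sum.elim_inr, hui, hvi] at h1
        linear_combination h1 - c (.inr 2) * (α + γ) * hp
      have hr2 : c (.inr 2) = 0 := by simpa using horb 0 0 1
      have hr1 : c (.inr 1) = 0 := by simpa using horb 0 1 0
      have hr0 : c (.inr 0) = 0 := by simpa [hr2] using horb 1 0 0
      simp only [hr0, hr1, hr2, zero_mul, add_zero] at hc
      -- Moving only `u_b` or only `v_b` differentiates `f_m` to the coefficient of `tᵐ` in `F_b(u +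
      -- t v)` or in `t F_b(u + t v)`. These give the hypotheses `ha` and `hb` of
      -- `coeffs_eq_zero_of_isNonsingular`.
      have hsum (b : Fin (n + 1)) (r s : Ω) (m : ℕ) :
          (tangentHom K z (Sum.elim (Pi.single b r) (Pi.single b s))
            ((restrictToLine F).coeff m)).snd =
          (lineRestriction (pderiv b F) (fun b => z (.inl b)) (fun b => z (.inr b)) *
            (Polynomial.C r + Polynomial.X * Polynomial.C s)).coeff m := by
        rw [snd_tangentHom_coeff_restrictToLine, Finset.sum_eq_single b]
        · simp
        · intro b' _ hb'
          simp [hb']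
        · simp
      obtain ⟨hl0, hl1, hl2⟩ := coeffs_eq_zero_of_isNonsingular F h3 hF hns hui hp
        (by rw [← lineRestriction_coeff_zero F _ fun b => z (.inr b),
          ← aeval_coeff_restrictToLine, hzf 0 (by norm_num)])
        (c₀ := c (.inl 0)) (c₁ := c (.inl 1)) (c₂ := c (.inl 2))
        (fun b => by
          have h1 := hc (Sum.elim (Pi.single b 1) (Pi.single b 0))
          simpa only [hsum, Polynomial.C_0, mul_zero, add_zero, Polynomial.C_1, mul_one] using h1)
        (fun b => by
          have h1 := hc (Sum.elim (Pi.single b 0) (Pi.single b 1))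
          simpa only [hsum, Polynomial.C_0, mul_zero, zero_add, Polynomial.C_1, mul_one,
            Polynomial.coeff_mul_X, Polynomial.coeff_mul_X_zero] using h1)
      rintro (m | m)
      · fin_cases m
        exacts [hl0, hl1, hl2]
      · fin_cases m
        exacts [hr0, hr1, hr2]
  have hcard : Fintype.card (Fin (n + 1) ⊕ Fin (n + 1)) - Fintype.card (Fin 3 ⊕ Fin 3) =
      2 * n - 4 := by
    simp only [Fintype.card_sum, Fintype.card_fin]
    omega
  rwa [hcard] at h

end

end PointLine

end

theorem theorem3 {K : Type*} [Field K] (n : ℕ) (hn : 2 ≤ n) (hchar : ringChar K ≠ 3)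
    (F : MvPolynomial (Fin (n + 1)) K) (hF : F.IsHomogeneous 3) :
    SmoothOfRelativeDimension (2 * n - 4) (PointLine.contactSchemeToSpec F hF 3) ↔
      SmoothOfRelativeDimension (n - 1) (PointLine.hypersurfaceToSpec F hF) := by
  have h3K : (3 : K) ≠ 0 := by
    intro h3
    have h1 : ringChar K ∣ 3 := ringChar.dvd (by exact_mod_cast h3)
    rcases (Nat.dvd_prime Nat.prime_three).mp h1 with h2 | h2
    · exact CharP.ringChar_ne_one h2
    · exact hchar h2
  have h3 : (3 : AlgebraicClosure K) ≠ 0 := by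
    rw [← map_ofNat (algebraMap K (AlgebraicClosure K)) 3]
    exact (map_ne_zero _).mpr h3K
  rw [PointLine.smoothOfRelativeDimension_hypersurfaceToSpec_iff F (AlgebraicClosure K)
    (by omega) hF]
  refine (PointLine.smoothOfRelativeDimension_projQuotToSpec_iff _ _ _).trans
    ((forall_congr' fun a => PointLine.contact_chartIsSmooth_iff F hF a _).trans ⟨?_, ?_⟩)
  · exact PointLine.isNonsingular_of_contact_smooth F hn hF
  · exact PointLine.contact_smooth_of_isNonsingular F h3 hF
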